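/- **Setting.** Let $G$ be a connected, undirected, unweighted graph with a root $r$. Its $t$-th layer $\mathcal L(t)$ is the (finite) set of nodes at distance exactly $t$ from $r$, and its width is $w=\max_t|\mathcal L(t)|$. For each node $u\ne r$ a neighbour $p(u)$ in the preceding layer is chosen arbitrarily; this gives a spanning tree, of which only the part up to depth $t$ is known when layer $t$ is revealed. For a tree revealed up to a nonempty layer $\mathcal L(t)$, let $V(t)$ be the set of nodes that lie on a path from $r$ to a node of $\mathcal L(t)$, let $c(u)$ be the set of children of $u$ in $V(t)$, and let $$K(t)=\Big\{x\in\mathbb R^{V(t)} : x_r=1,\ x_u=\sum_{v\in c(u)}x_v\ \text{ for all } u\in V(t)\setminus\mathcal L(t)\Big\}.$$ A *fractional algorithm* maps each such revealed tree to a probability distribution on its last layer; its cost up to layer $t$ is the sum over $s<t$ of the optimal transport costs, with respect to the tree distance, between the distributions chosen at layers $s$ and $s+1$. A *randomized algorithm* maps each such tree and a node of its penultimate layer to a distribution on the last layer, from which the next position of the agent is drawn; $\mathrm{Cost}(t)$ is the total number of tree edges traversed by the agent, who starts at $r$ and moves along shortest tree paths, until it reaches layer $t$. A randomized algorithm is *derived*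 from a fractional one if, at each step, the next position is drawn from the conditional distribution, given the current position, of an optimal coupling of the two consecutive distributions. An algorithm is *$c(w)$-competitive* if for every $w$, every such graph of width $w$, every choice of $p$, and every $t$ with $\mathcal L(t)\neq\emptyset$, its cost (for a randomized algorithm, $\mathbb E[\mathrm{Cost}(t)]$) up to layer $t$ is at most $c(w)\,t$. **Theorem.** For every revealed tree with nonempty last layer $\mathcal L(t)$, the function $\Phi_t(x)=\sum_{u\in V(t)}x_u\log x_u$ has a unique minimizer $x(t)$ over the points of $K(t)$ with all coordinates positive, and the restriction of $x(t)$ to $\mathcal L(t)$ is a probability distribution. There is a function $c:\mathbb N\to\mathbb R$ with $c(w)=O(\log^2 w)$ as $w\to\infty$ such that the fractional algorithm that plays $x(t)$ at each layer $t$ is $c(w)$-competitive, randomized algorithms derived from it exist, and every one of them is $c(w)$-competitive; that is, $$\mathbb E[\mathrm{Cost}(t)]\le c(w)\cdot t = O(\log^2 w)\cdot t .$$ -/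

import Mathlib

open Asymptotics Filter
open scoped ENNReal

universe u

noncomputable section

/-- A finite rooted tree with nodes in `V`, revealed up to depth `height`. The set `layer t`
consists of the nodes at depth `t`. Everything is determined by the revealed part: there are no
layers beyond `height`, and `parent` is `none` at the root and outside the tree. -/
structure LayeredTree (V : Type u) where
  root : V
  height : ℕ
  layer : ℕ → Finset V
  parent : V → Option V
  layer_zero : layer 0 = {root}
  layer_disjoint : ∀ s t, s ≠ t → Disjoint (layer s) (layer t)
  layer_of_height_lt : ∀ t, height < t → layer t = ∅
  parent_root : parent root = none
  parent_of_mem : ∀ t, ∀ v ∈ layer (t + 1), ∃ u ∈ layer t, parent v = some u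
  parent_of_notMem : ∀ v, (∀ t, v ∉ layer t) → parent v = none

namespace LayeredTree

variable {V : Type u} (T : LayeredTree V)

/-- The ultimate layer. It is allowed to be empty; all requirements on algorithms concern trees in
which it is not. -/
def lastLayer : Finset V := T.layer T.height

open Classical in
/-- All nodes of the tree. -/
def nodes : Finset V := (Finset.range (T.height + 1)).biUnion T.layer

/-- `u` is an ancestor of `v`, or `u = v`. -/
def IsAncestor (u v : V) : Prop := Relation.ReflTransGen (fun a b => T.parent b = some a) u v

open Classical in
/-- The nodes of the active tree, i.e. of the Steiner tree of the root and the ultimate layer. -/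
def activeNodes : Finset V := T.nodes.filter fun u => ∃ l ∈ T.lastLayer, T.IsAncestor u l

open Classical in
/-- The children of `u` in the active tree. -/
def activeChildren (u : V) : Finset V := T.activeNodes.filter fun v => T.parent v = some u

/-- The active polytope; configurations are extended by `0` outside the active tree and by the
value `1` at the root. There are no sign constraints. -/
def activePolytope : Set (V → ℝ) :=
  {x | x T.root = 1 ∧ (∀ u, u ∉ T.activeNodes → x u = 0) ∧
    ∀ u ∈ T.activeNodes, u ∉ T.lastLayer → x u = ∑ v ∈ T.activeChildren u, x v}

/-- The regularizer `Φ(x) = ∑ x_u log x_u`, the sum being over the active tree. -/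
def regularizer (x : V → ℝ) : ℝ := ∑ u ∈ T.activeNodes, x u * Real.log (x u)

/-- The points of the active polytope with positive entries on the active tree; this is where the
regularizer is minimized. -/
def positivePolytope : Set (V → ℝ) := {x | x ∈ T.activePolytope ∧ ∀ u ∈ T.activeNodes, 0 < x u}

/-- `x` minimizes the regularizer over the (positive part of the) active polytope. -/
def IsMinimizer (x : V → ℝ) : Prop :=
  x ∈ T.positivePolytope ∧ ∀ y ∈ T.positivePolytope, T.regularizer x ≤ T.regularizer y

/-- The tree as an undirected graph. -/
def graph : SimpleGraph V := SimpleGraph.fromRel fun u v => T.parent u = some v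

/-- Number of edges of the path between two nodes of the tree. -/
def dist (u v : V) : ℕ := T.graph.dist u v

open Classical in
/-- The part of the tree that was visible when layer `n` was revealed. -/
def truncate (n : ℕ) : LayeredTree V where
  root := T.root
  height := n
  layer t := if t ≤ n then T.layer t else ∅
  parent v := if v ∈ (Finset.range (n + 1)).biUnion T.layer then T.parent v else none
  layer_zero := by simp [T.layer_zero]
  layer_disjoint s t h := by
    have := T.layer_disjoint s t h
    split_ifs <;> simp [this]
  layer_of_height_lt t h := by simp [not_le.2 h]
  parent_root := by simp [T.parent_root]
  parent_of_mem t v hv := by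
    by_cases h : t + 1 ≤ n
    · rw [if_pos h] at hv
      obtain ⟨a, ha, hp⟩ := T.parent_of_mem t v hv
      refine ⟨a, ?_, ?_⟩
      · rw [if_pos (by omega)]; exact ha
      · rw [if_pos (Finset.mem_biUnion.2 ⟨t + 1, Finset.mem_range.2 (by omega), hv⟩)]; exact hp
    · rw [if_neg h] at hv; simp at hv
  parent_of_notMem v hv := by
    rw [if_neg]
    intro hm
    obtain ⟨t, ht, hvt⟩ := Finset.mem_biUnion.1 hm
    have := hv t
    rw [if_pos (Nat.lt_succ_iff.1 (Finset.mem_range.1 ht))] at this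
    exact this hvt

end LayeredTree

/-- `π` is a coupling of `μ` and `ν`. -/
def IsCoupling {V : Type u} (π : PMF (V × V)) (μ ν : PMF V) : Prop :=
  π.map Prod.fst = μ ∧ π.map Prod.snd = ν

/-- Expected distance between the two coordinates under `π`. -/
def transportCost {V : Type u} (d : V → V → ℕ) (π : PMF (V × V)) : ℝ≥0∞ :=
  ∑' z : V × V, π z * (d z.1 z.2 : ℝ≥0∞)

/-- Optimal transport cost (earth-mover distance) between `μ` and `ν`. -/
def optimalTransport {V : Type u} (d : V → V → ℕ) (μ ν : PMF V) : ℝ≥0∞ :=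
  ⨅ (π : PMF (V × V)) (_ : IsCoupling π μ ν), transportCost d π

/-- `π` is an optimal coupling of `μ` and `ν`. -/
def IsOptimalCoupling {V : Type u} (d : V → V → ℕ) (μ ν : PMF V) (π : PMF (V × V)) : Prop :=
  IsCoupling π μ ν ∧ transportCost d π = optimalTransport d μ ν

/-- A connected undirected unweighted graph on a subset `nodes` of `V`, with a root and with finite
layers. -/
structure RootedGraph (V : Type u) where
  graph : SimpleGraph V
  nodes : Set V
  root : V
  root_mem : root ∈ nodes
  mem_of_adj : ∀ a b, graph.Adj a b → a ∈ nodes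
  reachable : ∀ v ∈ nodes, graph.Reachable root v
  layer_finite : ∀ t : ℕ, {v | v ∈ nodes ∧ graph.dist root v = t}.Finite

namespace RootedGraph

variable {V : Type u} (G : RootedGraph V)

/-- The nodes that are `t` hops away from the root. -/
def layer (t : ℕ) : Finset V := (G.layer_finite t).toFinset

/-- `w` is the maximum cardinality of a layer. -/
def HasWidth (w : ℕ) : Prop := IsGreatest (Set.range fun t => (G.layer t).card) w

/-- A choice, for each node but the root, of a neighbour in the preceding layer. -/
structure ParentChoice where
  parent : V → V
  mem_layer : ∀ t, ∀ v ∈ G.layer (t + 1), parent v ∈ G.layer t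
  adj : ∀ t, ∀ v ∈ G.layer (t + 1), G.graph.Adj (parent v) v

theorem mem_layer_iff (t : ℕ) (v : V) :
    v ∈ G.layer t ↔ v ∈ G.nodes ∧ G.graph.dist G.root v = t := by
  simp [layer]

variable {G}

open Classical in
/-- The tree formed by the edges `(parent v, v)`, as it is visible when layer `t` is revealed. -/
def ParentChoice.tree (p : G.ParentChoice) (t : ℕ) : LayeredTree V where
  root := G.root
  height := t
  layer s := if s ≤ t then G.layer s else ∅
  parent v :=
    if v ∈ (Finset.range t).biUnion (fun s => G.layer (s + 1)) then some (p.parent v) else none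
  layer_zero := by
    ext v
    simp only [Nat.zero_le, if_true, mem_layer_iff, Finset.mem_singleton]
    constructor
    · rintro ⟨hv, h0⟩
      rcases SimpleGraph.dist_eq_zero_iff_eq_or_not_reachable.1 h0 with h | h
      · exact h.symm
      · exact absurd (G.reachable v hv) h
    · rintro rfl
      exact ⟨G.root_mem, SimpleGraph.dist_self⟩
  layer_disjoint s s' h := by
    have : Disjoint (G.layer s) (G.layer s') := by
      rw [Finset.disjoint_left]
      intro v h1 h2
      rw [mem_layer_iff] at h1 h2
      exact h (h1.2.symm.trans h2.2)
    split_ifs <;> simp [this]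
  layer_of_height_lt s h := by simp [not_le.2 h]
  parent_root := by
    rw [if_neg]
    intro hm
    obtain ⟨s, -, h⟩ := Finset.mem_biUnion.1 hm
    rw [mem_layer_iff, SimpleGraph.dist_self] at h
    omega
  parent_of_mem s v hv := by
    by_cases h : s + 1 ≤ t
    · rw [if_pos h] at hv
      refine ⟨p.parent v, ?_, ?_⟩
      · rw [if_pos (by omega)]; exact p.mem_layer s v hv
      · rw [if_pos (Finset.mem_biUnion.2 ⟨s, Finset.mem_range.2 (by omega), hv⟩)]
    · rw [if_neg h] at hv; simp at hv
  parent_of_notMem v hv := by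
    rw [if_neg]
    intro hm
    obtain ⟨s, hs, hvs⟩ := Finset.mem_biUnion.1 hm
    have := hv (s + 1)
    rw [if_pos (Nat.succ_le_of_lt (Finset.mem_range.1 hs))] at this
    exact this hvs

end RootedGraph

/-- A fractional algorithm maps a revealed tree to a distribution over its ultimate layer. -/
structure FractionalAlgorithm (V : Type u) where
  toFun : LayeredTree V → PMF V
  support_subset : ∀ T : LayeredTree V, T.lastLayer.Nonempty → (toFun T).support ⊆ T.lastLayer

/-- A randomized algorithm maps a revealed tree and a node of its penultimate layer to a
distribution over its ultimate layer. -/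
structure RandomizedAlgorithm (V : Type u) where
  toFun : LayeredTree V → V → PMF V
  support_subset : ∀ (T : LayeredTree V) (n : ℕ), T.height = n + 1 → T.lastLayer.Nonempty →
    ∀ a ∈ T.layer n, (toFun T a).support ⊆ T.lastLayer

namespace FractionalAlgorithm

variable {V : Type u} (F : FractionalAlgorithm V)

/-- The fractional algorithm plays, on the ultimate layer, the minimizer of the regularizer over
the active polytope. -/
def IsEntropic : Prop :=
  ∀ T : LayeredTree V, T.lastLayer.Nonempty →
    ∃ x : V → ℝ, T.IsMinimizer x ∧ ∀ l ∈ T.lastLayer, F.toFun T l = ENNReal.ofReal (x l)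

/-- Total cost up to layer `t`: the sum of the optimal transport costs between consecutive
distributions. -/
def cost {G : RootedGraph V} (p : G.ParentChoice) (t : ℕ) : ℝ≥0∞ :=
  ∑ s ∈ Finset.range t,
    optimalTransport (p.tree (s + 1)).dist (F.toFun (p.tree s)) (F.toFun (p.tree (s + 1)))

/-- The algorithm is `c(w)`-competitive. -/
def IsCompetitive (c : ℕ → ℝ) : Prop :=
  ∀ (w : ℕ) (G : RootedGraph V), G.HasWidth w → ∀ (p : G.ParentChoice) (t : ℕ),
    (G.layer t).Nonempty → F.cost p t ≤ ENNReal.ofReal (c w * t)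

end FractionalAlgorithm

namespace RandomizedAlgorithm

variable {V : Type u} (R : RandomizedAlgorithm V)

/-- `R` is derived from `F`: its next position is drawn from the conditional distribution, given the
present position, of an optimal coupling of the two consecutive distributions of `F`. -/
def IsDerivedFrom (F : FractionalAlgorithm V) : Prop :=
  ∀ (T : LayeredTree V) (n : ℕ), T.height = n + 1 → T.lastLayer.Nonempty →
    ∃ π : PMF (V × V), IsOptimalCoupling T.dist (F.toFun (T.truncate n)) (F.toFun T) π ∧
      ∀ a b, π (a, b) = F.toFun (T.truncate n) a * R.toFun T a b

/-- Joint law of the position of the agent when it reaches layer `t` and of the number `Cost(t)` of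
edges that it has traversed so far. -/
def law {G : RootedGraph V} (p : G.ParentChoice) : ℕ → PMF (V × ℕ)
  | 0 => PMF.pure (G.root, 0)
  | t + 1 => (law p t).bind fun s =>
      (R.toFun (p.tree (t + 1)) s.1).map fun v => (v, s.2 + (p.tree (t + 1)).dist s.1 v)

/-- The expectation of `Cost(t)`. -/
def expectedCost {G : RootedGraph V} (p : G.ParentChoice) (t : ℕ) : ℝ≥0∞ :=
  ∑' s : V × ℕ, R.law p t s * (s.2 : ℝ≥0∞)

/-- The algorithm is `c(w)`-competitive. -/
def IsCompetitive (c : ℕ → ℝ) : Prop :=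
  ∀ (w : ℕ) (G : RootedGraph V), G.HasWidth w → ∀ (p : G.ParentChoice) (t : ℕ),
    (G.layer t).Nonempty → R.expectedCost p t ≤ ENNReal.ofReal (c w * t)

end RandomizedAlgorithm

end

/-!
The tree revealed up to layer `n` is described by the leaf set `A` (its last layer) and the parent
map `par`. Nodes are indexed by their height `k` above the leaves, so that the active nodes of
height `k` are the image of `A` under `par^[k]`: deleting leaves does not change the height of the
remaining nodes, and a new layer raises all heights by one.

**The minimizer.** Eliminating the tree from the leaves upwards, the minimum of the regularizer on
the subtree below a node of height `k` that carries mass `1` is `-energy k`, where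
`energy (k + 1) u = (k + 1) * log (∑ exp (energy k v / (k + 1)))` over the children `v` of `u`. The
minimizer is the product `mass` of the conditional probabilities `trans`, a Gibbs distribution. The
linearization of the regularizer at `mass` is constant on the active polytope
(`sum_mul_log_mass`), so the excess of any other configuration is a relative entropy, which is
nonnegative and vanishes only at `mass`.

**Movement.** Matching common mass at every node, and passing the excess on to the parents, gives a
coupling whose cost is at most one plus the sum over all levels of the total variation between the
old and the new masses (`exists_coupling_mass`, `optimalTransport_le_of_weights`). Conversely a
change of transition probabilities below a node of height `k + 1` displaces mass on `k + 1` levels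
(`sum_Ico_le`). A step of the algorithm is cut into deletions of single leaves without children and
an extension in which every remaining leaf has children. With `L = log w`:

* *Deletion* of a leaf `l`. Let `a k` be the loss of energy at the ancestor of height `k`, and `q k`,
  `q' k` the conditional probabilities of that ancestor before and after. The identity
  `1 - q k = exp (-a (k + 1) / (k + 1)) * (1 - q' k)` shows that
  `(k + 1) * (q k - q' k) ≤ a (k + 1) * (1 - q' k)`, and convexity shows that the product of `a k`
  and the new mass is at most the loss of energy at the root. So the movement is at most this loss
  times `2 * (1 + ∑ (1 - q' k))`, and the sum is at most `-log x` for the new mass `x` of the lowest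
  surviving ancestor. If `x ≥ w⁻⁴`, this is `O(L)` times the loss of energy. Otherwise the loss of
  energy is at most `x * w * h * L`, where `h` is the number of nodes that become inactive, and the
  movement is `O(h * L / w)` (`levelDist_erase`).
* *Extension.* The energies grow by a number between `0` and `L`, so that at height `k` the logarithms
  of the transition probabilities change by at most `O(L / (k + 2))`. For `k ≥ 2 * L` the movement
  is at most `4 * L` times the sum of the conditional entropies, that is, the entropy of a layer, which
  is at most `L`. The lower levels contribute at most `2` each (`levelDist_extend`).

An extension adds at most `L` to the energy of the root and at most `w` to the number of active
nodes. Hence `potential`, a combination of both, pays for all deletions at the price of `O(L ^ 2)`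
per step, and summing over the steps telescopes.

**Randomized algorithms.** The set of couplings of two finitely supported distributions is compact,
so an optimal one exists, and conditioning it yields a derived algorithm. The law of the position of
such an algorithm is the distribution of the fractional algorithm, so both have the same cost.
-/

noncomputable section

/-! ### Gibbs distributions on a layered tree -/

namespace Leveled

open Classical Real

variable {V : Type u} (par : V → V) (A : Finset V)

/-- The nodes at height `k` of the tree spanned by the leaf set `A` under the parent map `par`. -/
def level (k : ℕ) : Finset V := A.image par^[k]

/-- The children, at height `k`, of the node `u` at height `k + 1`. -/
def children (k : ℕ) (u : V) : Finset V := (level par A k).filter fun v => par v = u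

/-- The free energy of the subtree below a node of height `k`: minus the least value of the
regularizer on that subtree when the node carries mass `1`. -/
def energy : ℕ → V → ℝ
  | 0, _ => 0
  | k + 1, u => (k + 1) * log (∑ v ∈ children par A k u, exp (energy k v / (k + 1)))

/-- The conditional probability of `v`, at height `k`, given its parent. -/
def trans (k : ℕ) (v : V) : ℝ :=
  exp ((energy par A k v - energy par A (k + 1) (par v)) / (k + 1))

/-- The conditional probability of `v`, at height `k`, given its ancestor `m` levels above. -/
def pathProb : ℕ → ℕ → V → ℝ
  | 0, _, _ => 1
  | m + 1, k, v => trans par A k v * pathProb m (k + 1) (par v)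

/-- The mass of `v`, at height `k`, in the entropic configuration of the tree of height `n`. -/
def mass (n k : ℕ) (v : V) : ℝ := if v ∈ level par A k then pathProb par A (n - k) k v else 0

/-- The number of leaves below `v`, a node of height `k`. -/
def leafCount (k : ℕ) (v : V) : ℕ := (A.filter fun a => par^[k] a = v).card

variable {par A}

lemma level_zero : level par A 0 = A := by simp [level]

lemma level_succ (k : ℕ) : level par A (k + 1) = (level par A k).image par := by
  simp only [level, Finset.image_image, Function.iterate_succ']

lemma par_mem_level {k : ℕ} {v : V} (hv : v ∈ level par A k) : par v ∈ level par A (k + 1) := by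
  rw [level_succ]; exact Finset.mem_image_of_mem _ hv

lemma level_nonempty (hA : A.Nonempty) (k : ℕ) : (level par A k).Nonempty := hA.image _

lemma card_level_le (k : ℕ) : (level par A k).card ≤ A.card := Finset.card_image_le

lemma level_mono {A' : Finset V} (h : A' ⊆ A) (k : ℕ) : level par A' k ⊆ level par A k :=
  Finset.image_subset_image h

lemma mem_children {k : ℕ} {u v : V} :
    v ∈ children par A k u ↔ v ∈ level par A k ∧ par v = u := by simp [children]

lemma children_nonempty {k : ℕ} {u : V} (hu : u ∈ level par A (k + 1)) :
    (children par A k u).Nonempty := by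
  rw [level_succ] at hu
  obtain ⟨v, hv, rfl⟩ := Finset.mem_image.1 hu
  exact ⟨v, mem_children.2 ⟨hv, rfl⟩⟩

lemma sum_level (k : ℕ) (f : V → ℝ) :
    ∑ v ∈ level par A k, f v = ∑ u ∈ level par A (k + 1), ∑ v ∈ children par A k u, f v :=
  (Finset.sum_fiberwise_of_maps_to (fun _ hv => par_mem_level hv) f).symm

lemma exp_energy {k : ℕ} {u : V} (hu : u ∈ level par A (k + 1)) :
    exp (energy par A (k + 1) u / (k + 1)) =
      ∑ v ∈ children par A k u, exp (energy par A k v / (k + 1)) := by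
  have hk : (k + 1 : ℝ) ≠ 0 := by positivity
  rw [energy, mul_div_cancel_left₀ _ hk, exp_log]
  exact Finset.sum_pos (fun _ _ => exp_pos _) (children_nonempty hu)

lemma trans_pos (k : ℕ) (v : V) : 0 < trans par A k v := exp_pos _

lemma trans_eq (k : ℕ) (v : V) : trans par A k v =
    exp (energy par A k v / (k + 1)) / exp (energy par A (k + 1) (par v) / (k + 1)) := by
  rw [trans, sub_div, exp_sub]

lemma sum_trans {k : ℕ} {u : V} (hu : u ∈ level par A (k + 1)) :
    ∑ v ∈ children par A k u, trans par A k v = 1 := by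
  have : ∑ v ∈ children par A k u, trans par A k v = ∑ v ∈ children par A k u,
      exp (energy par A k v / (k + 1)) / exp (energy par A (k + 1) u / (k + 1)) :=
    Finset.sum_congr rfl fun v hv => by rw [trans_eq, (mem_children.1 hv).2]
  rw [this, ← Finset.sum_div, ← exp_energy hu, div_self (exp_pos _).ne']

lemma trans_le_one {k : ℕ} {v : V} (hv : v ∈ level par A k) : trans par A k v ≤ 1 := by
  rw [← sum_trans (par_mem_level hv)]
  exact Finset.single_le_sum (f := trans par A k) (fun _ _ => (trans_pos _ _).le)
    (mem_children.2 ⟨hv, rfl⟩)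

lemma pathProb_pos (m k : ℕ) (v : V) : 0 < pathProb par A m k v := by
  induction m generalizing k v with
  | zero => exact one_pos
  | succ m ih => exact mul_pos (trans_pos _ _) (ih _ _)

lemma mass_pos {n k : ℕ} {v : V} (hv : v ∈ level par A k) : 0 < mass par A n k v := by
  rw [mass, if_pos hv]; exact pathProb_pos _ _ _

lemma mass_nonneg (n k : ℕ) (v : V) : 0 ≤ mass par A n k v := by
  by_cases hv : v ∈ level par A k
  · exact (mass_pos hv).le
  · rw [mass, if_neg hv]

lemma mass_of_notMem {n k : ℕ} {v : V} (hv : v ∉ level par A k) : mass par A n k v = 0 :=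
  if_neg hv

lemma mass_self {n : ℕ} {v : V} (hv : v ∈ level par A n) : mass par A n n v = 1 := by
  rw [mass, if_pos hv, Nat.sub_self, pathProb]

lemma mass_step {n k : ℕ} (hk : k < n) {v : V} (hv : v ∈ level par A k) :
    mass par A n k v = trans par A k v * mass par A n (k + 1) (par v) := by
  rw [mass, mass, if_pos hv, if_pos (par_mem_level hv),
    show n - k = (n - (k + 1)) + 1 by omega, pathProb]

lemma sum_children_mass {n k : ℕ} (hk : k < n) {u : V} (hu : u ∈ level par A (k + 1)) :
    ∑ v ∈ children par A k u, mass par A n k v = mass par A n (k + 1) u := by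
  have : ∑ v ∈ children par A k u, mass par A n k v =
      ∑ v ∈ children par A k u, trans par A k v * mass par A n (k + 1) u :=
    Finset.sum_congr rfl fun v hv => by
      rw [mass_step hk (mem_children.1 hv).1, (mem_children.1 hv).2]
  rw [this, ← Finset.sum_mul, sum_trans hu, one_mul]

lemma sum_mass {n k : ℕ} (hk : k ≤ n) {r : V} (hr : level par A n = {r}) :
    ∑ v ∈ level par A k, mass par A n k v = 1 := by
  induction hk using Nat.decreasingInduction with
  | self => rw [hr, Finset.sum_singleton, mass_self (by simp [hr])]
  | of_succ k hk ih =>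
    rw [← ih, sum_level]
    exact Finset.sum_congr rfl fun u hu => sum_children_mass hk hu

lemma leafCount_succ (k : ℕ) (u : V) :
    leafCount par A (k + 1) u = ∑ v ∈ children par A k u, leafCount par A k v := by
  unfold leafCount
  rw [Finset.card_eq_sum_card_fiberwise (f := par^[k]) (t := children par A k u)]
  · refine Finset.sum_congr rfl fun v hv => congrArg _ ?_
    ext a
    simp only [Finset.mem_filter, Function.iterate_succ_apply']
    constructor
    · rintro ⟨⟨h1, _⟩, h3⟩; exact ⟨h1, h3⟩
    · rintro ⟨h1, h3⟩; exact ⟨⟨h1, by rw [h3, (mem_children.1 hv).2]⟩, h3⟩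
  · intro a ha
    simp only [Finset.coe_filter, Set.mem_ofPred_eq, Function.iterate_succ_apply'] at ha
    exact mem_children.2 ⟨Finset.mem_image_of_mem _ ha.1, ha.2⟩

lemma leafCount_pos {k : ℕ} {v : V} (hv : v ∈ level par A k) : 0 < leafCount par A k v := by
  obtain ⟨a, ha, rfl⟩ := Finset.mem_image.1 hv
  exact Finset.card_pos.2 ⟨a, by simp [ha]⟩

lemma leafCount_le (k : ℕ) (v : V) : leafCount par A k v ≤ A.card := Finset.card_filter_le _ _

lemma energy_nonneg (k : ℕ) {v : V} (hv : v ∈ level par A k) : 0 ≤ energy par A k v := by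
  induction k generalizing v with
  | zero => exact le_rfl
  | succ k ih =>
    obtain ⟨w, hw⟩ := children_nonempty hv
    refine mul_nonneg (by positivity) (log_nonneg ?_)
    calc (1 : ℝ) ≤ exp (energy par A k w / (k + 1)) :=
          one_le_exp (div_nonneg (ih (mem_children.1 hw).1) (by positivity))
      _ ≤ _ := Finset.single_le_sum (f := fun v => exp (energy par A k v / (k + 1)))
          (fun _ _ => (exp_pos _).le) hw

/-- The energy is at most that of a tree which branches into all of its leaves at once. -/
lemma energy_le (k : ℕ) {v : V} (hv : v ∈ level par A k) :
    energy par A k v ≤ k * log (leafCount par A k v) := by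
  induction k generalizing v with
  | zero => simp [energy]
  | succ k ih =>
    have hk : (0 : ℝ) < k + 1 := by positivity
    rw [energy, Nat.cast_succ]
    refine mul_le_mul_of_nonneg_left (log_le_log
      (Finset.sum_pos (fun _ _ => exp_pos _) (children_nonempty hv)) ?_) hk.le
    rw [leafCount_succ, Nat.cast_sum]
    refine Finset.sum_le_sum fun w hw => ?_
    have hw := (mem_children.1 hw).1
    have h1 : (1 : ℝ) ≤ leafCount par A k w := by exact_mod_cast leafCount_pos hw
    rw [← le_log_iff_exp_le (by linarith), div_le_iff₀ hk]
    nlinarith [ih hw, log_nonneg h1]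

lemma energy_le_log_card (k : ℕ) {v : V} (hv : v ∈ level par A k) {w : ℕ} (hw : A.card ≤ w) :
    energy par A k v ≤ k * log w := by
  have := leafCount_pos hv
  refine (energy_le k hv).trans (mul_le_mul_of_nonneg_left (log_le_log (by exact_mod_cast this) ?_)
    (by positivity))
  exact_mod_cast (leafCount_le k v).trans hw

/-- A change of transition probabilities at height `k` moves mass by at most the change at the
parent level plus the weighted change of the transition probabilities. -/
lemma sum_abs_sub_le (k : ℕ) {x x' y y' q q' : V → ℝ}
    (hx : ∀ v ∈ level par A k, x v = q v * y (par v))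
    (hx' : ∀ v ∈ level par A k, x' v = q' v * y' (par v))
    (hq0 : ∀ v ∈ level par A k, 0 ≤ q v)
    (hq : ∀ u ∈ level par A (k + 1), ∑ v ∈ children par A k u, q v = 1)
    (hy' : ∀ u, 0 ≤ y' u) :
    ∑ v ∈ level par A k, |x v - x' v| ≤ ∑ u ∈ level par A (k + 1), |y u - y' u| +
      ∑ v ∈ level par A k, |q v - q' v| * y' (par v) := by
  have h1 : ∀ v ∈ level par A k, |x v - x' v| ≤
      q v * |y (par v) - y' (par v)| + |q v - q' v| * y' (par v) := by
    intro v hv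
    rw [hx v hv, hx' v hv]
    calc |q v * y (par v) - q' v * y' (par v)|
        = |q v * (y (par v) - y' (par v)) + (q v - q' v) * y' (par v)| := by ring_nf
      _ ≤ _ := (abs_add_le _ _).trans (by
        rw [abs_mul, abs_mul, abs_of_nonneg (hq0 v hv), abs_of_nonneg (hy' _)])
  refine (Finset.sum_le_sum h1).trans ?_
  rw [Finset.sum_add_distrib]
  refine add_le_add_left (le_of_eq ?_) _
  rw [sum_level]
  refine Finset.sum_congr rfl fun u hu => ?_
  have : ∑ v ∈ children par A k u, q v * |y (par v) - y' (par v)| =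
      ∑ v ∈ children par A k u, q v * |y u - y' u| :=
    Finset.sum_congr rfl fun v hv => by rw [(mem_children.1 hv).2]
  rw [this, ← Finset.sum_mul, hq u hu, one_mul]

/-- Mass that is displaced at height `k` stays displaced on the `k + 1` levels from there down. -/
lemma sum_Ico_le {H n : ℕ} (hH : H ≤ n) {S τ : ℕ → ℝ}
    (hτ : ∀ k, 0 ≤ τ k) (hn : S n = 0) (hS : ∀ k < n, S k ≤ S (k + 1) + τ k) :
    ∑ k ∈ Finset.Ico H (n + 1), S k ≤ ∑ k ∈ Finset.Ico H n, (k + 1) * τ k := by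
  have key : ∀ m, H ≤ m → m ≤ n → ∑ k ∈ Finset.Ico H (m + 1), S k ≤
      ∑ k ∈ Finset.Ico H m, (k + 1) * τ k + (m + 1 - H) * S m := by
    intro m hm
    induction m, hm using Nat.le_induction with
    | base => intro _; simp
    | succ m hm ih =>
      intro hmn
      rw [Finset.sum_Ico_succ_top (by omega), Finset.sum_Ico_succ_top hm (fun k : ℕ => (k + 1) * τ k)]
      have h1 := ih (by omega)
      have h2 := hS m (by omega)
      have h3 : (H : ℝ) ≤ m := by exact_mod_cast hm
      have h4 : (0 : ℝ) ≤ H := by positivity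
      push_cast
      nlinarith [hτ m, mul_le_mul_of_nonneg_left h2 (by linarith : (0 : ℝ) ≤ m + 1 - H),
        mul_nonneg h4 (hτ m)]
  simpa [hn] using key n hH le_rfl

end Leveled

namespace Leveled

open Classical Real

/-! ### Deleting a leaf -/

section Erase

variable {V : Type u} {par : V → V} {A : Finset V} {l : V}

lemma level_eq_insert (hl : l ∈ A) (k : ℕ) :
    level par A k = insert (par^[k] l) (level par (A.erase l) k) := by
  unfold level
  rw [← Finset.image_insert, Finset.insert_erase hl]

lemma iterate_mem_level (hl : l ∈ A) (k : ℕ) : par^[k] l ∈ level par A k :=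
  Finset.mem_image_of_mem _ hl

lemma mem_level_erase (hl : l ∈ A) {k : ℕ} {v : V} (hv : v ∈ level par A k)
    (hne : v ≠ par^[k] l) : v ∈ level par (A.erase l) k := by
  rw [level_eq_insert hl] at hv
  exact (Finset.mem_insert.1 hv).resolve_left hne

lemma level_erase_subset (k : ℕ) : level par (A.erase l) k ⊆ level par A k :=
  level_mono (Finset.erase_subset _ _) k

lemma children_erase (hl : l ∈ A) {k : ℕ} {u : V} (hu : u ≠ par^[k + 1] l) :
    children par A k u = children par (A.erase l) k u := by
  ext v
  simp only [mem_children]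
  refine ⟨fun ⟨h1, h2⟩ => ⟨mem_level_erase hl h1 ?_, h2⟩,
    fun ⟨h1, h2⟩ => ⟨level_erase_subset _ h1, h2⟩⟩
  rintro rfl
  exact hu (by rw [← h2, Function.iterate_succ_apply'])

lemma energy_erase (hl : l ∈ A) (k : ℕ) {v : V} (hv : v ≠ par^[k] l) :
    energy par A k v = energy par (A.erase l) k v := by
  induction k generalizing v with
  | zero => rfl
  | succ k ih =>
    rw [energy, energy, children_erase hl hv]
    congr 2
    refine Finset.sum_congr rfl fun w hw => ?_
    rw [ih]
    rintro rfl
    exact hv (by rw [← (mem_children.1 hw).2, Function.iterate_succ_apply'])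

variable (par A l) in
/-- The loss of energy at the ancestor of height `k` of a deleted leaf `l`. -/
def gap (k : ℕ) : ℝ := energy par A k (par^[k] l) - energy par (A.erase l) k (par^[k] l)

variable (par A l) in
/-- The transition probabilities after the deletion of the leaf `l`, with value `0` at the nodes
that are no longer active. -/
def transErase (k : ℕ) (v : V) : ℝ :=
  if v ∈ level par (A.erase l) k then trans par (A.erase l) k v else 0

lemma transErase_of_mem {k : ℕ} {v : V} (h : v ∈ level par (A.erase l) k) :
    transErase par A l k v = trans par (A.erase l) k v := if_pos h

lemma transErase_nonneg (k : ℕ) (v : V) : 0 ≤ transErase par A l k v := by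
  unfold transErase
  split_ifs
  · exact (trans_pos _ _).le
  · exact le_rfl

lemma transErase_le_one (k : ℕ) (v : V) : transErase par A l k v ≤ 1 := by
  unfold transErase
  split_ifs with h
  · exact trans_le_one h
  · exact zero_le_one

lemma sum_transErase {k : ℕ} {u : V} (hu : u ∈ level par (A.erase l) (k + 1)) :
    ∑ v ∈ children par A k u, transErase par A l k v = 1 := by
  rw [← sum_trans hu]
  symm
  refine (Finset.sum_congr rfl fun v hv => ?_).trans (Finset.sum_subset
    (f := transErase par A l k) (s₁ := children par (A.erase l) k u) (fun v hv => ?_)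
    fun v hv hv' => ?_)
  · rw [transErase_of_mem (mem_children.1 hv).1]
  · exact mem_children.2 ⟨level_erase_subset _ (mem_children.1 hv).1, (mem_children.1 hv).2⟩
  · exact if_neg fun h => hv' (mem_children.2 ⟨h, (mem_children.1 hv).2⟩)

lemma iterate_mem_children (hl : l ∈ A) (k : ℕ) :
    par^[k] l ∈ children par A k (par^[k + 1] l) :=
  mem_children.2 ⟨iterate_mem_level hl k, (Function.iterate_succ_apply' _ _ _).symm⟩

/-- The siblings of the deleted branch gain a common factor. -/
lemma trans_eq_sibling (hl : l ∈ A) {k : ℕ} {v : V}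
    (hv : v ∈ (children par A k (par^[k + 1] l)).erase (par^[k] l)) :
    trans par A k v = exp (-(gap par A l (k + 1) / (k + 1))) * transErase par A l k v := by
  obtain ⟨hne, hv⟩ := Finset.mem_erase.1 hv
  obtain ⟨hv, hp⟩ := mem_children.1 hv
  rw [transErase_of_mem (mem_level_erase hl hv hne), trans, trans, ← exp_add, gap,
    energy_erase hl k hne, hp]
  congr 1
  ring

lemma one_sub_trans (hl : l ∈ A) {k : ℕ} (hk : par^[k + 1] l ∈ level par (A.erase l) (k + 1)) :
    1 - trans par A k (par^[k] l) =
      exp (-(gap par A l (k + 1) / (k + 1))) * (1 - transErase par A l k (par^[k] l)) := by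
  have hm := iterate_mem_children (par := par) hl k
  have h1 := sum_trans (level_erase_subset _ hk)
  have h2 := sum_transErase hk
  rw [← Finset.add_sum_erase _ _ hm] at h1 h2
  rw [← eq_sub_iff_add_eq'.2 h1, ← eq_sub_iff_add_eq'.2 h2, Finset.mul_sum]
  exact Finset.sum_congr rfl fun v hv => trans_eq_sibling hl hv

lemma trans_sub_le (hl : l ∈ A) {k : ℕ} (hk : par^[k + 1] l ∈ level par (A.erase l) (k + 1)) :
    (k + 1) * (trans par A k (par^[k] l) - transErase par A l k (par^[k] l)) ≤
      gap par A l (k + 1) * (1 - transErase par A l k (par^[k] l)) := by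
  have h1 := one_sub_trans hl hk
  set b := gap par A l (k + 1) / (k + 1) with hb
  have h2 := add_one_le_exp (-b)
  have h3 := transErase_le_one (par := par) (A := A) (l := l) k (par^[k] l)
  have hk0 : (0 : ℝ) < k + 1 := by positivity
  have h4 : gap par A l (k + 1) = (k + 1) * b := by rw [hb]; field_simp
  rw [h4, mul_assoc]
  refine mul_le_mul_of_nonneg_left ?_ hk0.le
  nlinarith

lemma trans_eq_gap {k : ℕ} (hk : par^[k] l ∈ level par (A.erase l) k) :
    trans par A k (par^[k] l) = transErase par A l k (par^[k] l) *
      exp (gap par A l k / (k + 1) - gap par A l (k + 1) / (k + 1)) := by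
  rw [transErase_of_mem hk, trans, trans, ← exp_add, gap, gap, Function.iterate_succ_apply']
  congr 1
  ring

/-- Jensen's inequality for the exponential of a two-valued random variable. -/
lemma mul_le_of_exp_mixture {q t b c : ℝ} (h0 : 0 ≤ q) (h1 : q ≤ 1)
    (ht : t = q * exp (c - b)) (ht' : 1 - t = exp (-b) * (1 - q)) : q * c ≤ b := by
  have e1 := add_one_le_exp (c - q * c)
  have e2 := add_one_le_exp (-(q * c))
  have e3 : exp (q * c - b) * (q * exp (c - q * c) + (1 - q) * exp (-(q * c))) = 1 := by
    have : exp (q * c - b) * (q * exp (c - q * c) + (1 - q) * exp (-(q * c))) =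
        q * (exp (q * c - b) * exp (c - q * c)) +
          (exp (q * c - b) * exp (-(q * c))) * (1 - q) := by ring
    rw [this, ← exp_add, ← exp_add, show q * c - b + (c - q * c) = c - b by ring,
      show q * c - b + -(q * c) = -b by ring, ← ht, ← ht']
    ring
  have e4 : 1 ≤ q * exp (c - q * c) + (1 - q) * exp (-(q * c)) := by
    nlinarith [mul_le_mul_of_nonneg_left e1 h0,
      mul_le_mul_of_nonneg_left e2 (by linarith : 0 ≤ 1 - q)]
  have e5 : exp (q * c - b) ≤ 1 := by
    nlinarith [exp_pos (q * c - b)]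
  rw [exp_le_one_iff] at e5
  linarith

lemma le_mul_of_exp_mixture {q t b c : ℝ} (h0 : 0 ≤ t) (h1 : t ≤ 1)
    (ht : t = q * exp (c - b)) (ht' : 1 - t = exp (-b) * (1 - q)) : b ≤ t * c := by
  have := mul_le_of_exp_mixture (q := t) (t := q) (b := -b) (c := -c) h0 h1
    (by rw [ht, mul_assoc, ← exp_add]; simp)
    (by rw [ht', ← mul_assoc, ← exp_add]; simp)
  linarith

lemma mul_gap_le (hl : l ∈ A) {k : ℕ} (hk : par^[k] l ∈ level par (A.erase l) k) :
    trans par (A.erase l) k (par^[k] l) * gap par A l k ≤ gap par A l (k + 1) := by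
  have hk' : par^[k + 1] l ∈ level par (A.erase l) (k + 1) := by
    rw [Function.iterate_succ_apply']; exact par_mem_level hk
  have := mul_le_of_exp_mixture (transErase_nonneg _ _) (transErase_le_one _ _)
    (trans_eq_gap hk) (one_sub_trans hl hk')
  rwa [← mul_div_assoc, div_le_div_iff_of_pos_right (by positivity), transErase_of_mem hk] at this

lemma gap_succ_le (hl : l ∈ A) {k : ℕ} (hk : par^[k] l ∈ level par (A.erase l) k) :
    gap par A l (k + 1) ≤ trans par A k (par^[k] l) * gap par A l k := by
  have hk' : par^[k + 1] l ∈ level par (A.erase l) (k + 1) := by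
    rw [Function.iterate_succ_apply']; exact par_mem_level hk
  have := le_mul_of_exp_mixture (trans_pos _ _).le (trans_le_one (iterate_mem_level hl k))
    (trans_eq_gap hk) (one_sub_trans hl hk')
  rwa [← mul_div_assoc, div_le_div_iff_of_pos_right (by positivity)] at this

lemma gap_nonneg (hl : l ∈ A) {k : ℕ} (hk : par^[k] l ∈ level par (A.erase l) k) :
    0 ≤ gap par A l k := by
  induction k with
  | zero => simp [gap, energy]
  | succ k ih =>
    by_cases h : par^[k] l ∈ level par (A.erase l) k
    · exact (mul_nonneg (trans_pos _ _).le (ih h)).trans (mul_gap_le hl h)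
    · have h1 := one_sub_trans hl hk
      have h2 : transErase par A l k (par^[k] l) = 0 := if_neg h
      rw [h2, sub_zero, mul_one] at h1
      have h3 : exp (-(gap par A l (k + 1) / (k + 1))) ≤ 1 := by
        linarith [trans_pos (par := par) (A := A) k (par^[k] l)]
      rw [exp_le_one_iff, neg_nonpos] at h3
      have hk0 : (0 : ℝ) < k + 1 := by positivity
      simpa [div_mul_cancel₀ _ hk0.ne'] using mul_nonneg h3 hk0.le

lemma iterate_mem_level_of_le {h k : ℕ} (hh : par^[h] l ∈ level par A h)
    (hk : h ≤ k) : par^[k] l ∈ level par A k := by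
  induction k, hk using Nat.le_induction with
  | base => exact hh
  | succ k _ ih => rw [Function.iterate_succ_apply']; exact par_mem_level ih

lemma mass_iterate {n k : ℕ} (hk : k < n) (h : par^[k] l ∈ level par A k) :
    mass par A n k (par^[k] l) =
      trans par A k (par^[k] l) * mass par A n (k + 1) (par^[k + 1] l) := by
  rw [mass_step hk h, Function.iterate_succ_apply']

/-- The new mass of a surviving ancestor times its loss of energy grows towards the root. -/
lemma mass_mul_gap_le (hl : l ∈ A) {h n : ℕ} (hh : par^[h] l ∈ level par (A.erase l) h)
    {k : ℕ} (hk : h ≤ k) (hkn : k ≤ n) :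
    mass par (A.erase l) n k (par^[k] l) * gap par A l k ≤ gap par A l n := by
  induction hkn using Nat.decreasingInduction with
  | self => rw [mass_self (iterate_mem_level_of_le hh hk), one_mul]
  | of_succ k hkn ih =>
    have hm := iterate_mem_level_of_le hh hk
    rw [mass_iterate hkn hm, mul_comm (trans _ _ _ _), mul_assoc]
    exact (mul_le_mul_of_nonneg_left (mul_gap_le hl hm) (mass_nonneg _ _ _)).trans
      (ih (by omega))

/-- The old mass of a surviving ancestor times its loss of energy decreases towards the root. -/
lemma gap_le_mass_mul (hl : l ∈ A) {h n : ℕ} (hh : par^[h] l ∈ level par (A.erase l) h)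
    {k : ℕ} (hk : h ≤ k) (hkn : k ≤ n) :
    gap par A l n ≤ mass par A n k (par^[k] l) * gap par A l k := by
  induction hkn using Nat.decreasingInduction with
  | self => rw [mass_self (iterate_mem_level hl _), one_mul]
  | of_succ k hkn ih =>
    have hm := iterate_mem_level_of_le hh hk
    rw [mass_iterate hkn (iterate_mem_level hl _), mul_comm (trans _ _ _ _), mul_assoc]
    exact (ih (by omega)).trans (mul_le_mul_of_nonneg_left (gap_succ_le hl hm)
      (mass_nonneg _ _ _))

/-- The deletion of a leaf cannot reduce the mass of a surviving ancestor too much. -/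
lemma mass_le_mass_erase (hl : l ∈ A) {h n : ℕ} (h0 : 0 < h)
    (hh : par^[h] l ∈ level par (A.erase l) h) {k : ℕ} (hk : h ≤ k) (hkn : k ≤ n) :
    mass par A n k (par^[k] l) ≤ mass par (A.erase l) n k (par^[k] l) *
      exp ((gap par A l k - gap par A l n) / h) := by
  induction hkn using Nat.decreasingInduction with
  | self =>
    rw [mass_self (iterate_mem_level hl _), mass_self (iterate_mem_level_of_le hh hk)]
    simp
  | of_succ k hkn ih =>
    have hm := iterate_mem_level_of_le hh hk
    have hle : gap par A l (k + 1) ≤ gap par A l k := (gap_succ_le hl hm).trans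
      (mul_le_of_le_one_left (gap_nonneg hl hm) (trans_le_one (iterate_mem_level hl k)))
    have h1 : (gap par A l k - gap par A l (k + 1)) / (k + 1) ≤
        (gap par A l k - gap par A l (k + 1)) / h := by
      refine div_le_div_of_nonneg_left (by linarith) (by exact_mod_cast h0) ?_
      exact_mod_cast hk.trans (Nat.le_succ k)
    have h2 : trans par A k (par^[k] l) ≤ trans par (A.erase l) k (par^[k] l) *
        exp ((gap par A l k - gap par A l (k + 1)) / h) := by
      rw [trans_eq_gap hm, transErase_of_mem hm, ← sub_div]
      exact mul_le_mul_of_nonneg_left (exp_le_exp.2 h1) (trans_pos _ _).le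
    rw [mass_iterate hkn (iterate_mem_level hl _), mass_iterate hkn hm]
    refine (mul_le_mul h2 (ih (by omega)) (mass_nonneg _ _ _)
      (mul_nonneg (trans_pos _ _).le (exp_pos _).le)).trans (le_of_eq ?_)
    rw [mul_mul_mul_comm, ← exp_add]
    congr 2
    ring

lemma sum_one_sub_trans_le {h n : ℕ} (hhn : h ≤ n) (hh : par^[h] l ∈ level par A h) :
    ∑ k ∈ Finset.Ico h n, (1 - trans par A k (par^[k] l)) ≤
      -log (mass par A n h (par^[h] l)) := by
  induction hhn using Nat.decreasingInduction with
  | self => rw [mass_self hh]; simp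
  | of_succ k hkn ih =>
    have hh' := iterate_mem_level_of_le hh (Nat.le_succ k)
    rw [Finset.sum_eq_sum_Ico_succ_bot hkn, mass_iterate hkn hh,
      log_mul (trans_pos _ _).ne' (mass_pos hh').ne']
    have := ih hh'
    have := log_le_sub_one_of_pos (trans_pos (par := par) (A := A) k (par^[k] l))
    linarith

lemma sum_abs_sub_of_le {s : Finset V} {a : V} (ha : a ∈ s) {f g : V → ℝ}
    (hs : ∑ v ∈ s, f v = ∑ v ∈ s, g v) (h : ∀ v ∈ s.erase a, f v ≤ g v) :
    ∑ v ∈ s, |f v - g v| = 2 * (f a - g a) := by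
  rw [← Finset.add_sum_erase _ _ ha, ← Finset.add_sum_erase _ _ ha] at hs
  rw [← Finset.add_sum_erase _ _ ha]
  have h1 : ∑ v ∈ s.erase a, |f v - g v| = ∑ v ∈ s.erase a, g v - ∑ v ∈ s.erase a, f v := by
    rw [← Finset.sum_sub_distrib]
    exact Finset.sum_congr rfl fun v hv => by rw [abs_sub_comm, abs_of_nonneg]; linarith [h v hv]
  have h2 : 0 ≤ ∑ v ∈ s.erase a, |f v - g v| := Finset.sum_nonneg fun _ _ => abs_nonneg _
  rw [h1] at h2 ⊢
  rw [abs_of_nonneg (by linarith)]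
  linarith

/-- The weighted change of the transition probabilities at height `k` is confined to the children
of the ancestor of the deleted leaf. -/
lemma sum_abs_trans_sub (hl : l ∈ A) (n k : ℕ) :
    ∑ v ∈ level par A k, |trans par A k v - transErase par A l k v| *
        mass par (A.erase l) n (k + 1) (par v) =
      2 * (trans par A k (par^[k] l) - transErase par A l k (par^[k] l)) *
        mass par (A.erase l) n (k + 1) (par^[k + 1] l) := by
  rw [sum_level, Finset.sum_eq_single (par^[k + 1] l)]
  · have : ∀ v ∈ children par A k (par^[k + 1] l),
        |trans par A k v - transErase par A l k v| *
        mass par (A.erase l) n (k + 1) (par v) = |trans par A k v - transErase par A l k v| *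
        mass par (A.erase l) n (k + 1) (par^[k + 1] l) :=
      fun v hv => by rw [(mem_children.1 hv).2]
    rw [Finset.sum_congr rfl this, ← Finset.sum_mul]
    by_cases hk : par^[k + 1] l ∈ level par (A.erase l) (k + 1)
    · rw [sum_abs_sub_of_le (iterate_mem_children hl k)
        ((sum_trans (level_erase_subset _ hk)).trans (sum_transErase hk).symm)]
      intro v hv
      rw [trans_eq_sibling hl hv]
      refine mul_le_of_le_one_left (transErase_nonneg _ _) ?_
      rw [exp_le_one_iff, neg_nonpos]
      exact div_nonneg (gap_nonneg hl hk) (by positivity)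
    · rw [mass_of_notMem hk, mul_zero, mul_zero]
  · intro u _ hu
    refine Finset.sum_eq_zero fun v hv => ?_
    obtain ⟨hv', rfl⟩ := mem_children.1 hv
    have hne : v ≠ par^[k] l := by
      rintro rfl; exact hu (Function.iterate_succ_apply' _ _ _).symm
    rw [transErase_of_mem (mem_level_erase hl hv' hne), trans, trans, energy_erase hl k hne,
      energy_erase hl (k + 1) hu]
    simp
  · intro h
    exact absurd (iterate_mem_level hl _) h

variable (par) in
/-- Total variation, summed over the levels from the leaf level `A` to the root level, between two
families of masses. -/
def levelDist (A : Finset V) (n : ℕ) (x y : ℕ → V → ℝ) : ℝ :=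
  ∑ k ∈ Finset.range (n + 1), ∑ v ∈ level par A k, |x k v - y k v|

/-- The movement caused by the deletion of a leaf, in terms of the loss of energy and of the mass
left at the lowest surviving ancestor, which has height `m + 1`. -/
lemma levelDist_erase_le (hl : l ∈ A) {n : ℕ} {r : V} (hr : level par A n = {r})
    (hr' : level par (A.erase l) n = {r}) {m : ℕ} (hm : m < n)
    (hm0 : par^[m] l ∉ level par (A.erase l) m)
    (hm1 : par^[m + 1] l ∈ level par (A.erase l) (m + 1)) :
    levelDist par A n (mass par A n) (mass par (A.erase l) n) ≤
      2 * gap par A l n * (1 - log (mass par (A.erase l) n (m + 1) (par^[m + 1] l))) := by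
  set τ : ℕ → ℝ := fun k => ∑ v ∈ level par A k, |trans par A k v - transErase par A l k v| *
    mass par (A.erase l) n (k + 1) (par v) with hτ
  have hS := sum_Ico_le (H := 0) (n := n) (Nat.zero_le n) (τ := τ)
    (S := fun k => ∑ v ∈ level par A k, |mass par A n k v - mass par (A.erase l) n k v|)
    (fun k => Finset.sum_nonneg fun v _ => mul_nonneg (abs_nonneg _) (mass_nonneg _ _ _))
    (by
      have h1 : r ∈ level par A n := by simp [hr]
      have h2 : r ∈ level par (A.erase l) n := by simp [hr']
      simp only [hr, Finset.sum_singleton, mass_self h1, mass_self h2, sub_self, abs_zero])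
    (fun k hk => by
      refine sum_abs_sub_le k (fun v hv => mass_step hk hv) (fun v hv => ?_)
        (fun v _ => (trans_pos _ _).le) (fun u hu => sum_trans hu) (fun u => mass_nonneg _ _ _)
      by_cases h : v ∈ level par (A.erase l) k
      · rw [transErase_of_mem h, mass_step hk h]
      · rw [mass_of_notMem h, transErase, if_neg h, zero_mul])
  rw [levelDist, Finset.range_eq_Ico]
  refine hS.trans ?_
  have hup : ∀ k, m ≤ k → par^[k + 1] l ∈ level par (A.erase l) (k + 1) :=
    fun k hk => iterate_mem_level_of_le hm1 (by omega)
  have hbound : ∀ k, m ≤ k → k < n → (k + 1) * τ k ≤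
      2 * gap par A l n * (1 - transErase par A l k (par^[k] l)) := by
    intro k hk hkn
    have h1 := trans_sub_le hl (hup k hk)
    have h2 := mass_mul_gap_le hl hm1 (show m + 1 ≤ k + 1 by omega) hkn
    have h3 := transErase_le_one (par := par) (A := A) (l := l) k (par^[k] l)
    have h4 := mass_nonneg (par := par) (A := A.erase l) n (k + 1) (par^[k + 1] l)
    simp only [hτ]
    rw [sum_abs_trans_sub hl]
    nlinarith [mul_le_mul_of_nonneg_right h1 h4,
      mul_le_mul_of_nonneg_right h2 (by linarith : 0 ≤ 1 - transErase par A l k (par^[k] l))]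
  rw [← Finset.sum_Ico_consecutive _ (Nat.zero_le m) hm.le, Finset.sum_eq_sum_Ico_succ_bot hm,
    Finset.sum_eq_zero, zero_add]
  · have h1 : ∑ k ∈ Finset.Ico (m + 1) n, (k + 1) * τ k ≤
        ∑ k ∈ Finset.Ico (m + 1) n,
          2 * gap par A l n * (1 - trans par (A.erase l) k (par^[k] l)) := by
      refine Finset.sum_le_sum fun k hk => ?_
      obtain ⟨h1, h2⟩ := Finset.mem_Ico.1 hk
      rw [← transErase_of_mem (iterate_mem_level_of_le hm1 h1)]
      exact hbound k (by omega) h2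
    rw [← Finset.mul_sum] at h1
    have h2 := hbound m le_rfl hm
    rw [show transErase par A l m (par^[m] l) = 0 from if_neg hm0] at h2
    have h3 := sum_one_sub_trans_le (show m + 1 ≤ n from hm) hm1
    have h4 : 0 ≤ gap par A l n := gap_nonneg hl (iterate_mem_level_of_le hm1 hm)
    nlinarith [mul_le_mul_of_nonneg_left h3 h4]
  · intro k hk
    have hk := (Finset.mem_Ico.1 hk).2
    have : par^[k + 1] l ∉ level par (A.erase l) (k + 1) := fun h =>
      hm0 (iterate_mem_level_of_le h hk)
    simp only [hτ]
    rw [sum_abs_trans_sub hl, mass_of_notMem this, mul_zero, mul_zero]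

variable (par) in
/-- The number of active nodes other than the root. -/
def nodeCount (A : Finset V) (n : ℕ) : ℕ := ∑ k ∈ Finset.range n, (level par A k).card

lemma nodeCount_erase (hl : l ∈ A) {n m : ℕ} (hm : m < n)
    (hm0 : par^[m] l ∉ level par (A.erase l) m)
    (hm1 : par^[m + 1] l ∈ level par (A.erase l) (m + 1)) :
    nodeCount par A n = nodeCount par (A.erase l) n + (m + 1) := by
  have hm' : m + 1 ≤ n := hm
  unfold nodeCount
  rw [← Finset.sum_range_add_sum_Ico _ hm', ← Finset.sum_range_add_sum_Ico _ hm']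
  have h1 : ∑ k ∈ Finset.range (m + 1), (level par A k).card =
      ∑ k ∈ Finset.range (m + 1), ((level par (A.erase l) k).card + 1) := by
    refine Finset.sum_congr rfl fun k hk => ?_
    rw [level_eq_insert hl, Finset.card_insert_of_notMem]
    have := Finset.mem_range.1 hk
    exact fun h => hm0 (iterate_mem_level_of_le h (by omega))
  have h2 : ∑ k ∈ Finset.Ico (m + 1) n, (level par A k).card =
      ∑ k ∈ Finset.Ico (m + 1) n, (level par (A.erase l) k).card := by
    refine Finset.sum_congr rfl fun k hk => ?_
    rw [level_eq_insert hl, Finset.insert_eq_of_mem]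
    exact iterate_mem_level_of_le hm1 (Finset.mem_Ico.1 hk).1
  rw [h1, h2, Finset.sum_add_distrib]
  simp
  omega

lemma neg_mul_log_le_two_sqrt {x : ℝ} (hx : 0 < x) : x * -log x ≤ 2 * √x := by
  have h1 : 0 < √x := sqrt_pos.2 hx
  have h2 := log_le_sub_one_of_pos (inv_pos.2 h1)
  rw [log_inv, log_sqrt hx.le] at h2
  have h3 : √x * √x = x := mul_self_sqrt hx.le
  have h4 : x * (√x)⁻¹ = √x := by
    field_simp
    nlinarith
  nlinarith [mul_le_mul_of_nonneg_left h2 hx.le]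

/-- The movement caused by the deletion of a leaf is paid by the loss of energy and, if little
mass is left at the lowest surviving ancestor, by the loss of active nodes. -/
lemma levelDist_erase (hl : l ∈ A) {n : ℕ} {r : V} (hr : level par A n = {r})
    (hne : (A.erase l).Nonempty) {w : ℕ} (hw : A.card ≤ w) :
    levelDist par A n (mass par A n) (mass par (A.erase l) n) ≤
      2 * (1 + 4 * log w) * (energy par A n r - energy par (A.erase l) n r) +
      4 * log w / w * (nodeCount par A n - nodeCount par (A.erase l) n) := by
  have hr' : level par (A.erase l) n = {r} := by
    refine (Finset.subset_singleton_iff.1 (hr ▸ level_erase_subset n)).resolve_left ?_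
    exact (level_nonempty hne n).ne_empty
  have hln : par^[n] l = r := by
    have := iterate_mem_level (par := par) hl n
    rwa [hr, Finset.mem_singleton] at this
  have hex : ∃ k, par^[k] l ∈ level par (A.erase l) k := ⟨n, by rw [hln, hr']; simp⟩
  obtain ⟨m, hm⟩ : ∃ m, Nat.find hex = m + 1 := by
    refine Nat.exists_eq_succ_of_ne_zero fun h => ?_
    have := Nat.find_spec hex
    rw [h, level_zero] at this
    exact Finset.notMem_erase l A this
  have hm1 : par^[m + 1] l ∈ level par (A.erase l) (m + 1) := hm ▸ Nat.find_spec hex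
  have hm0 : par^[m] l ∉ level par (A.erase l) m := Nat.find_min hex (by omega)
  have hmn : m < n := by
    by_contra h
    exact hm0 (iterate_mem_level_of_le (h := n) (by rw [hln, hr']; simp) (by omega))
  have hw1 : (1 : ℝ) ≤ w := by exact_mod_cast (Finset.card_pos.2 ⟨l, hl⟩).trans_le hw
  have hL : 0 ≤ log w := log_nonneg hw1
  have hmain := levelDist_erase_le hl hr hr' hmn hm0 hm1
  have hgap : energy par A n r - energy par (A.erase l) n r = gap par A l n := by
    rw [gap, hln]
  have hg0 : 0 ≤ gap par A l n := gap_nonneg hl (iterate_mem_level_of_le hm1 hmn)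
  rw [hgap, nodeCount_erase hl hmn hm0 hm1]
  push_cast
  rw [add_sub_cancel_left]
  refine hmain.trans ?_
  have hg1 := gap_le_mass_mul (n := n) hl hm1 le_rfl hmn
  have hg2 := mass_le_mass_erase (n := n) hl (Nat.succ_pos m) hm1 le_rfl hmn
  have hg3 : gap par A l (m + 1) ≤ (m + 1) * log w := by
    have h1 := energy_le_log_card (m + 1) (iterate_mem_level (par := par) hl (m + 1)) hw
    have h2 := energy_nonneg (m + 1) hm1
    push_cast at h1
    rw [gap]; linarith
  have hg4 : 0 ≤ gap par A l (m + 1) := gap_nonneg hl hm1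
  set x := mass par A n (m + 1) (par^[m + 1] l)
  set x' := mass par (A.erase l) n (m + 1) (par^[m + 1] l) with hx'
  have hx'0 : 0 < x' := mass_pos hm1
  have hexp : exp ((gap par A l (m + 1) - gap par A l n) / (m + 1 : ℕ)) ≤ w := by
    rw [← le_log_iff_exp_le (by linarith), div_le_iff₀ (by positivity)]
    push_cast
    linarith
  have hxx : x ≤ x' * w := hg2.trans (mul_le_mul_of_nonneg_left hexp hx'0.le)
  have hga : gap par A l n ≤ x' * w * ((m + 1) * log w) :=
    hg1.trans (mul_le_mul hxx hg3 hg4 (by positivity))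
  -- the threshold `w⁻⁴` for `x'` makes `√x'` at most `w⁻²`
  by_cases hc : -log x' ≤ 4 * log w
  · have : 0 ≤ 4 * log w / w * ((m : ℝ) + 1) := by positivity
    nlinarith [mul_le_mul_of_nonneg_left hc hg0]
  · push Not at hc
    have hsq : √x' ≤ 1 / (w : ℝ) ^ 2 := by
      have h1 : x' ≤ (1 / (w : ℝ) ^ 2) ^ 2 := by
        rw [← log_le_log_iff hx'0 (by positivity), log_pow, log_div one_ne_zero (by positivity),
          log_pow, log_one]
        push_cast
        linarith
      exact (sqrt_le_sqrt h1).trans (by rw [sqrt_sq (by positivity)])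
    have hlog := neg_mul_log_le_two_sqrt hx'0
    have hneg : 0 ≤ -log x' := by linarith
    have h1 : gap par A l n * -log x' ≤ 2 * log w / w * (m + 1) := by
      calc gap par A l n * -log x' ≤ x' * w * ((m + 1) * log w) * -log x' :=
            mul_le_mul_of_nonneg_right hga hneg
        _ = (x' * -log x') * (w * ((m + 1) * log w)) := by ring
        _ ≤ (2 * (1 / (w : ℝ) ^ 2)) * (w * ((m + 1) * log w)) := by
            refine mul_le_mul_of_nonneg_right ?_ (by positivity)
            linarith
        _ = 2 * log w / w * (m + 1) := by field_simp
    have h2 : 0 ≤ gap par A l n * log w := by positivity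
    have h3 : 4 * log w / w * ((m : ℝ) + 1) = 2 * (2 * log w / w * (m + 1)) := by ring
    rw [h3]
    nlinarith

end Erase

end Leveled

namespace Leveled

open Classical Real

/-! ### Revealing a new layer -/

section Extend

variable {V : Type u} {par : V → V} {A B : Finset V}

lemma level_image (k : ℕ) : level par (B.image par) k = level par B (k + 1) := by
  simp only [level, Finset.image_image]
  rfl

lemma children_image (k : ℕ) (u : V) :
    children par (B.image par) k u = children par B (k + 1) u := by
  simp only [children, level_image]

lemma energy_le_par {k : ℕ} {v : V} (hv : v ∈ level par A k) :
    energy par A k v ≤ energy par A (k + 1) (par v) := by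
  have h := trans_le_one hv
  rw [trans, exp_le_one_iff] at h
  have hk : (0 : ℝ) < k + 1 := by positivity
  have := mul_nonpos_of_nonpos_of_nonneg h hk.le
  rw [div_mul_cancel₀ _ hk.ne'] at this
  linarith

lemma energy_image_le (k : ℕ) {v : V} (hv : v ∈ level par (B.image par) k) :
    energy par (B.image par) k v ≤ energy par B (k + 1) v := by
  induction k generalizing v with
  | zero => exact energy_nonneg _ (level_image (par := par) (B := B) 0 ▸ hv)
  | succ k ih =>
    have hv' : v ∈ level par B (k + 1 + 1) := level_image (par := par) (B := B) _ ▸ hv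
    have h1 := exp_energy hv'
    have hk2 : (0 : ℝ) < ((k + 1 : ℕ) : ℝ) + 1 := by positivity
    rw [← div_le_div_iff_of_pos_right hk2, ← exp_le_exp, h1, ← children_image]
    have hs := sum_trans hv
    calc exp (energy par (B.image par) (k + 1) v / ((k + 1 : ℕ) + 1))
        = ∑ c ∈ children par (B.image par) k v, trans par (B.image par) k c *
            exp (energy par (B.image par) (k + 1) v / ((k + 1 : ℕ) + 1)) := by
          rw [← Finset.sum_mul, hs, one_mul]
      _ ≤ _ := by
          refine Finset.sum_le_sum fun c hc => ?_
          obtain ⟨hc, hp⟩ := mem_children.1 hc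
          have h2 := ih hc
          have h3 := energy_le_par hc
          rw [trans, ← exp_add, exp_le_exp, hp]
          rw [hp] at h3
          set e := energy par (B.image par) k c
          set e' := energy par (B.image par) (k + 1) v
          have h4 : (e - e') / (k + 1) ≤ (e - e') / ((k + 1 : ℕ) + 1) := by
            push_cast
            rw [div_le_div_iff₀ (by positivity) (by positivity)]
            nlinarith
          refine (add_le_add_left h4 _).trans ?_
          rw [← add_div, sub_add_cancel]
          exact div_le_div_of_nonneg_right h2 hk2.le

/-- Hölder's inequality for the exponents `(k + 2) / (k + 1)` and `k + 2`, at each node. -/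
lemma energy_le_image_add (k : ℕ) {v : V} (hv : v ∈ level par (B.image par) k) :
    energy par B (k + 1) v ≤
      energy par (B.image par) k v + log (leafCount par B (k + 1) v) := by
  induction k generalizing v with
  | zero =>
    rw [level_image] at hv
    simpa [energy] using energy_le 1 hv
  | succ k ih =>
    have hv' : v ∈ level par B (k + 1 + 1) := level_image (par := par) (B := B) _ ▸ hv
    have h1 := exp_energy hv'
    have hk2 : (0 : ℝ) < ((k + 1 : ℕ) : ℝ) + 1 := by positivity
    have hn : (0 : ℝ) < leafCount par B (k + 1 + 1) v := by exact_mod_cast leafCount_pos hv'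
    rw [← div_le_div_iff_of_pos_right hk2, ← exp_le_exp, h1, ← children_image]
    set e' := energy par (B.image par) (k + 1) v with he'
    set N : ℝ := ((leafCount par B (k + 1 + 1) v : ℕ) : ℝ) with hN
    have hs := sum_trans hv
    have hs' : ∑ c ∈ children par (B.image par) k v, (leafCount par B (k + 1) c : ℝ) / N = 1 := by
      rw [← Finset.sum_div, children_image, ← Nat.cast_sum, ← leafCount_succ, div_self hn.ne']
    calc ∑ c ∈ children par (B.image par) k v, exp (energy par B (k + 1) c / ((k + 1 : ℕ) + 1))
        ≤ ∑ c ∈ children par (B.image par) k v,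
          ((k + 1) / ((k + 1 : ℕ) + 1) * trans par (B.image par) k c +
            1 / ((k + 1 : ℕ) + 1) * (leafCount par B (k + 1) c / N)) *
          exp ((e' + log N) / ((k + 1 : ℕ) + 1)) := by
          refine Finset.sum_le_sum fun c hc => ?_
          have hcB := (mem_children.1 (children_image (par := par) (B := B) k v ▸ hc)).1
          obtain ⟨hc, hp⟩ := mem_children.1 hc
          have hc0 : (0 : ℝ) < leafCount par B (k + 1) c := by exact_mod_cast leafCount_pos hcB
          have h2 := ih hc
          have h3 := convexOn_exp.2 (Set.mem_univ
            ((energy par (B.image par) k c - e') / (k + 1)))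
            (Set.mem_univ (log (leafCount par B (k + 1) c) - log N))
            (show 0 ≤ (k + 1 : ℝ) / ((k + 1 : ℕ) + 1) by positivity)
            (show 0 ≤ (1 : ℝ) / ((k + 1 : ℕ) + 1) by positivity)
            (by push_cast; field_simp)
          simp only [smul_eq_mul] at h3
          rw [exp_sub, exp_log hc0, exp_log hn, he', ← hp, ← trans, hp] at h3
          refine le_trans ?_ (mul_le_mul_of_nonneg_right h3 (exp_pos _).le)
          rw [← exp_add, exp_le_exp]
          refine (div_le_div_of_nonneg_right h2 hk2.le).trans (le_of_eq ?_)
          push_cast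
          field_simp
          ring
      _ = _ := by
          rw [← Finset.sum_mul, Finset.sum_add_distrib, ← Finset.mul_sum, ← Finset.mul_sum, hs,
            hs', mul_one, mul_one, ← add_div]
          push_cast
          rw [div_self (by positivity), one_mul]

lemma energy_extend_le {w : ℕ} (hw : B.card ≤ w) (k : ℕ) {v : V}
    (hv : v ∈ level par (B.image par) k) :
    energy par B (k + 1) v ≤ energy par (B.image par) k v + log w := by
  have hv' := hv
  rw [level_image] at hv'
  have h1 := leafCount_pos hv'
  have h2 : log (leafCount par B (k + 1) v) ≤ log w :=
    log_le_log (by exact_mod_cast h1) (by exact_mod_cast (leafCount_le _ _).trans hw)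
  linarith [energy_le_image_add k hv]

/-- Tilting a distribution by logarithmic weights of size `ε` moves an atom `t` by at most the
multiple `exp (2 * ε) - 1` of `t * (1 - t)`. -/
lemma abs_tilt_sub_le {s : Finset V} {t t' δ : V → ℝ} {ζ ε : ℝ} (ht0 : ∀ v ∈ s, 0 ≤ t v)
    (ht : ∑ v ∈ s, t v = 1) (ht' : ∑ v ∈ s, t' v = 1)
    (h : ∀ v ∈ s, t' v = t v * exp (δ v - ζ)) (hδ : ∀ v ∈ s, |δ v| ≤ ε) {a : V} (ha : a ∈ s) :
    |t' a - t a| ≤ t a * (1 - t a) * (exp (2 * ε) - 1) := by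
  have hζ : exp ζ = ∑ v ∈ s, t v * exp (δ v) := by
    have : ∑ v ∈ s, t v * exp (δ v) = (∑ v ∈ s, t' v) * exp ζ := by
      rw [Finset.sum_mul]
      refine Finset.sum_congr rfl fun v hv => ?_
      rw [h v hv, mul_assoc, ← exp_add, sub_add_cancel]
    rw [this, ht', one_mul]
  have hlow : exp (-ε) ≤ exp ζ := by
    rw [hζ]
    calc exp (-ε) = ∑ v ∈ s, t v * exp (-ε) := by rw [← Finset.sum_mul, ht, one_mul]
      _ ≤ _ := Finset.sum_le_sum fun v hv => mul_le_mul_of_nonneg_left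
        (exp_le_exp.2 (neg_le_of_abs_le (hδ v hv))) (ht0 v hv)
  have hdiff : exp (δ a) - exp ζ = ∑ v ∈ s.erase a, t v * (exp (δ a) - exp (δ v)) := by
    have : exp (δ a) - exp ζ = ∑ v ∈ s, t v * (exp (δ a) - exp (δ v)) := by
      simp only [mul_sub, Finset.sum_sub_distrib]
      rw [← Finset.sum_mul, ht, one_mul, hζ]
    rw [this, ← Finset.add_sum_erase _ _ ha, sub_self, mul_zero, zero_add]
  have hsum : ∑ v ∈ s.erase a, t v = 1 - t a := by
    rw [← ht, ← Finset.add_sum_erase _ _ ha]; ring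
  have habs : |exp (δ a) - exp ζ| ≤ (1 - t a) * (exp ε - exp (-ε)) := by
    rw [hdiff, ← hsum, Finset.sum_mul]
    refine (Finset.abs_sum_le_sum_abs _ _).trans (Finset.sum_le_sum fun v hv => ?_)
    have hv := Finset.mem_of_mem_erase hv
    rw [abs_mul, abs_of_nonneg (ht0 v hv)]
    refine mul_le_mul_of_nonneg_left (abs_le.2 ⟨?_, ?_⟩) (ht0 v hv)
    · linarith [exp_le_exp.2 (neg_le_of_abs_le (hδ a ha)), exp_le_exp.2 (le_of_abs_le (hδ v hv))]
    · linarith [exp_le_exp.2 (neg_le_of_abs_le (hδ v hv)), exp_le_exp.2 (le_of_abs_le (hδ a ha))]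
  have h1 : t' a - t a = t a * ((exp (δ a) - exp ζ) * exp (-ζ)) := by
    rw [h a ha, sub_mul, ← exp_add, ← exp_add]
    simp only [add_neg_cancel, exp_zero, ← sub_eq_add_neg]
    ring
  have h2 : exp (-ζ) ≤ exp ε := by
    rw [exp_le_exp] at hlow ⊢; linarith
  rw [h1, abs_mul, abs_mul, abs_of_nonneg (ht0 a ha), abs_of_pos (exp_pos _), mul_assoc]
  refine mul_le_mul_of_nonneg_left ?_ (ht0 a ha)
  have h3 := mul_le_mul habs h2 (exp_pos _).le ((abs_nonneg _).trans habs)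
  refine h3.trans (le_of_eq ?_)
  rw [mul_assoc, sub_mul (exp ε), ← exp_add, ← exp_add, neg_add_cancel, exp_zero, two_mul]

/-- The bound `t * (1 - t)` is weakened to the entropy term `t * -log t`, whose sum along the tree is
the entropy of a layer. -/
lemma abs_trans_extend_sub_le {w : ℕ} (hw : B.card ≤ w) {k : ℕ} (hk : 2 * log w ≤ k + 2) {v : V}
    (hv : v ∈ level par (B.image par) k) :
    (k + 1) * |trans par B (k + 1) v - trans par (B.image par) k v| ≤
      4 * log w * (trans par (B.image par) k v * -log (trans par (B.image par) k v)) := by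
  have hA : (B.image par).card ≤ w := Finset.card_image_le.trans hw
  have hw1 : (1 : ℝ) ≤ w := by
    have := Finset.card_pos.2 ⟨v, hv⟩
    exact_mod_cast (this.trans_le (card_level_le k)).trans_le hA
  have hL : 0 ≤ log w := log_nonneg hw1
  have hu := par_mem_level hv
  have huB : par v ∈ level par B (k + 1 + 1) := level_image (par := par) (B := B) _ ▸ hu
  have key := abs_tilt_sub_le (s := children par (B.image par) k (par v))
    (t := trans par (B.image par) k) (t' := trans par B (k + 1))
    (δ := fun c => energy par B (k + 1) c / (k + 2) - energy par (B.image par) k c / (k + 1))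
    (ζ := energy par B (k + 2) (par v) / (k + 2) -
      energy par (B.image par) (k + 1) (par v) / (k + 1))
    (ε := log w / (k + 2)) (fun c _ => (trans_pos _ _).le) (sum_trans hu)
    (by rw [children_image]; exact sum_trans huB)
    (fun c hc => by
      rw [trans, trans, ← exp_add, (mem_children.1 hc).2]
      congr 1
      push_cast
      rw [sub_div, sub_div]
      ring_nf)
    (fun c hc => by
      have hc := (mem_children.1 hc).1
      have h1 := energy_image_le k hc
      have h2 := energy_extend_le hw k hc
      have h3 := energy_nonneg k hc
      have h4 := energy_le_log_card k hc hA
      have h5 : energy par (B.image par) k c / (k + 1) ≤ log w := by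
        rw [div_le_iff₀ (by positivity)]
        linarith
      have h6 : 0 ≤ energy par (B.image par) k c / (k + 1) := div_nonneg h3 (by positivity)
      have h7 : energy par B (k + 1) c / (k + 2) - energy par (B.image par) k c / (k + 1) =
          ((energy par B (k + 1) c - energy par (B.image par) k c) -
            energy par (B.image par) k c / (k + 1)) / (k + 2) := by
        field_simp
        ring
      rw [h7, abs_div, abs_of_pos (show (0 : ℝ) < k + 2 by positivity)]
      refine div_le_div_of_nonneg_right (abs_le.2 ⟨?_, ?_⟩) (by positivity) <;> linarith)
    (mem_children.2 ⟨hv, rfl⟩)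
  set t := trans par (B.image par) k v with ht
  have ht0 : 0 < t := trans_pos _ _
  have hε0 : 0 ≤ 2 * (log w / (k + 2)) := by positivity
  have hε1 : 2 * (log w / (k + 2)) ≤ 1 := by
    rw [← mul_div_assoc, div_le_one (by positivity)]; exact hk
  have hexp : exp (2 * (log w / (k + 2))) - 1 ≤ 2 * (2 * (log w / (k + 2))) := by
    have := abs_exp_sub_one_le (x := 2 * (log w / (k + 2))) (by rwa [abs_of_nonneg hε0])
    rw [abs_of_nonneg hε0] at this
    exact (le_abs_self _).trans this
  have ht1 : t ≤ 1 := trans_le_one hv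
  have hlog : 1 - t ≤ -log t := by linarith [log_le_sub_one_of_pos ht0]
  calc (k + 1) * |trans par B (k + 1) v - t|
      ≤ (k + 1) * (t * (1 - t) * (2 * (2 * (log w / (k + 2))))) := by
        refine mul_le_mul_of_nonneg_left (key.trans ?_) (by positivity)
        exact mul_le_mul_of_nonneg_left hexp (mul_nonneg ht0.le (by linarith))
    _ = 4 * log w * ((k + 1) / (k + 2)) * (t * (1 - t)) := by ring
    _ ≤ 4 * log w * 1 * (t * (1 - t)) := by
        refine mul_le_mul_of_nonneg_right (mul_le_mul_of_nonneg_left ?_ (by positivity))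
          (mul_nonneg ht0.le (by linarith))
        rw [div_le_one (by positivity)]; linarith
    _ ≤ 4 * log w * (t * -log t) := by
        rw [mul_one]
        exact mul_le_mul_of_nonneg_left (mul_le_mul_of_nonneg_left hlog ht0.le) (by positivity)

lemma neg_sum_mul_log_le {s : Finset V} {m : V → ℝ} (hm : ∀ v ∈ s, 0 < m v)
    (hs : ∑ v ∈ s, m v = 1) : ∑ v ∈ s, m v * -log (m v) ≤ log s.card := by
  have hne : s.Nonempty := by
    rw [Finset.nonempty_iff_ne_empty]; rintro rfl; simp at hs
  have hN : (0 : ℝ) < s.card := by exact_mod_cast hne.card_pos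
  have h1 : ∑ v ∈ s, (m v * -log (m v) - m v * log s.card) ≤
      ∑ v ∈ s, (1 / (s.card : ℝ) - m v) := by
    refine Finset.sum_le_sum fun v hv => ?_
    have hv := hm v hv
    have h2 := log_le_sub_one_of_pos (show 0 < 1 / (m v * s.card) by positivity)
    rw [log_div one_ne_zero (by positivity), log_one, log_mul hv.ne' hN.ne'] at h2
    have h3 := mul_le_mul_of_nonneg_left h2 hv.le
    have h4 : m v * (1 / (m v * s.card) - 1) = 1 / (s.card : ℝ) - m v := by field_simp
    rw [h4] at h3
    linarith
  rw [Finset.sum_sub_distrib, Finset.sum_sub_distrib, ← Finset.sum_mul, hs, Finset.sum_const,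
    nsmul_eq_mul, mul_one_div, div_self hN.ne'] at h1
  linarith

/-- Chain rule for the entropy. -/
lemma sum_entropy_trans {n H : ℕ} (hH : H ≤ n) {r : V} (hr : level par A n = {r}) :
    ∑ k ∈ Finset.Ico H n, ∑ v ∈ level par A k, mass par A n k v * -log (trans par A k v) =
      ∑ v ∈ level par A H, mass par A n H v * -log (mass par A n H v) := by
  induction hH using Nat.decreasingInduction with
  | self => simp [hr, mass_self (show r ∈ level par A n by simp [hr])]
  | of_succ k hk ih =>
    rw [Finset.sum_eq_sum_Ico_succ_bot hk, ih]
    have h1 : ∑ v ∈ level par A k, mass par A n k v * -log (mass par A n k v) =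
        ∑ v ∈ level par A k, (mass par A n k v * -log (trans par A k v) +
          mass par A n k v * -log (mass par A n (k + 1) (par v))) := by
      refine Finset.sum_congr rfl fun v hv => ?_
      conv_lhs => rw [mass_step hk hv, log_mul (trans_pos _ _).ne'
        (mass_pos (par_mem_level hv)).ne', ← mass_step hk hv]
      ring
    rw [h1, Finset.sum_add_distrib]
    congr 1
    rw [sum_level k]
    refine Finset.sum_congr rfl fun u hu => ?_
    rw [← sum_children_mass hk hu, Finset.sum_mul]
    refine Finset.sum_congr rfl fun v hv => ?_
    rw [(mem_children.1 hv).2, sum_children_mass hk hu]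

lemma sum_abs_sub_le_two {s : Finset V} {x y : V → ℝ}
    (hx0 : ∀ v ∈ s, 0 ≤ x v) (hy0 : ∀ v ∈ s, 0 ≤ y v)
    (hx : ∑ v ∈ s, x v = 1) (hy : ∑ v ∈ s, y v = 1) : ∑ v ∈ s, |x v - y v| ≤ 2 := by
  calc ∑ v ∈ s, |x v - y v| ≤ ∑ v ∈ s, (x v + y v) := Finset.sum_le_sum fun v hv =>
        abs_le.2 ⟨by linarith [hx0 v hv, hy0 v hv], by linarith [hx0 v hv, hy0 v hv]⟩
    _ = 2 := by rw [Finset.sum_add_distrib, hx, hy]; norm_num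

/-- The movement caused by a new layer, when all nodes of the preceding layer have children. Near
the leaves it is bounded by the number of levels, and further up by the entropy. -/
lemma levelDist_extend {w : ℕ} (hw : B.card ≤ w) (hB : B.Nonempty) {n : ℕ} {r : V}
    (hr : level par (B.image par) n = {r}) :
    levelDist par (B.image par) n (mass par (B.image par) n)
      (fun k => mass par B (n + 1) (k + 1)) ≤ 2 * (2 * log w + 1) + 4 * log w ^ 2 := by
  set A := B.image par with hA
  have hrB : level par B (n + 1) = {r} := by rw [← level_image, hr]
  have hw1 : (1 : ℝ) ≤ w := by exact_mod_cast hB.card_pos.trans_le hw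
  have hL : 0 ≤ log w := log_nonneg hw1
  set S : ℕ → ℝ := fun k => ∑ v ∈ level par A k, |mass par B (n + 1) (k + 1) v - mass par A n k v|
    with hS
  have hS2 : ∀ k ≤ n, S k ≤ 2 := fun k hk =>
    sum_abs_sub_le_two (fun _ _ => mass_nonneg _ _ _)
      (fun _ _ => mass_nonneg _ _ _)
      (by rw [hA, level_image]; exact sum_mass (by omega) hrB) (sum_mass hk hr)
  have hLD : levelDist par A n (mass par A n) (fun k => mass par B (n + 1) (k + 1)) =
      ∑ k ∈ Finset.range (n + 1), S k := by
    unfold levelDist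
    simp only [hS, abs_sub_comm]
  rw [hLD]
  have hceil := Nat.ceil_lt_add_one (show 0 ≤ 2 * log w by positivity)
  set H := ⌈2 * log w⌉₊ with hH
  have hlow : ∀ m ≤ n + 1, ∑ k ∈ Finset.range m, S k ≤ 2 * m := fun m hm => by
    calc ∑ k ∈ Finset.range m, S k ≤ ∑ k ∈ Finset.range m, (2 : ℝ) :=
          Finset.sum_le_sum fun k hk => hS2 k (by have := Finset.mem_range.1 hk; omega)
      _ = 2 * m := by simp [mul_comm]
  by_cases hHn : H ≤ n
  · rw [← Finset.sum_range_add_sum_Ico _ (show H ≤ n + 1 by omega)]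
    have h1 := hlow H (by omega)
    set τ : ℕ → ℝ := fun k => ∑ v ∈ level par A k, |trans par B (k + 1) v - trans par A k v| *
      mass par A n (k + 1) (par v) with hτ
    have h2 := sum_Ico_le hHn (S := S) (τ := τ)
      (fun k => Finset.sum_nonneg fun v _ => mul_nonneg (abs_nonneg _) (mass_nonneg _ _ _))
      (by
        have e1 : r ∈ level par A n := by simp [hr]
        have e2 : r ∈ level par B (n + 1) := by simp [hrB]
        simp only [hS, hr, Finset.sum_singleton, mass_self e1, mass_self e2, sub_self, abs_zero])
      (fun k hk => by
        refine sum_abs_sub_le k (fun v hv => ?_) (fun v hv => mass_step hk hv)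
          (fun v _ => (trans_pos _ _).le) (fun u hu => ?_) (fun u => mass_nonneg _ _ _)
        · rw [hA, level_image] at hv
          exact mass_step (by omega) hv
        · rw [hA, level_image] at hu
          rw [hA, children_image]
          exact sum_trans hu)
    have h3 : ∑ k ∈ Finset.Ico H n, (k + 1) * τ k ≤ 4 * log w * ∑ k ∈ Finset.Ico H n,
        ∑ v ∈ level par A k, mass par A n k v * -log (trans par A k v) := by
      rw [Finset.mul_sum]
      refine Finset.sum_le_sum fun k hk => ?_
      obtain ⟨hk1, hk2⟩ := Finset.mem_Ico.1 hk
      simp only [hτ]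
      rw [Finset.mul_sum, Finset.mul_sum]
      refine Finset.sum_le_sum fun v hv => ?_
      have hk3 : 2 * log w ≤ k + 2 := by
        have e1 := Nat.le_ceil (2 * log w)
        have e2 : (H : ℝ) ≤ k := by exact_mod_cast hk1
        linarith
      have := mul_le_mul_of_nonneg_right (abs_trans_extend_sub_le hw hk3 hv)
        (mass_nonneg (par := par) (A := A) n (k + 1) (par v))
      rw [mass_step hk2 hv]
      linarith
    rw [sum_entropy_trans hHn hr] at h3
    have h4 := neg_sum_mul_log_le (fun v hv => mass_pos (n := n) hv) (sum_mass hHn hr)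
    have h5 : log (level par A H).card ≤ log w := by
      refine log_le_log ?_ ?_
      · exact_mod_cast (level_nonempty (hB.image par) H).card_pos
      · exact_mod_cast ((card_level_le H).trans Finset.card_image_le).trans hw
    have h6 := mul_le_mul_of_nonneg_left (h4.trans h5) (show 0 ≤ 4 * log w by positivity)
    nlinarith
  · have h1 := hlow (n + 1) le_rfl
    have h2 : ((n + 1 : ℕ) : ℝ) ≤ H := by exact_mod_cast (by omega : n + 1 ≤ H)
    nlinarith [sq_nonneg (log w)]

lemma nodeCount_succ (n : ℕ) :
    nodeCount par B (n + 1) = nodeCount par (B.image par) n + B.card := by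
  unfold nodeCount
  rw [Finset.sum_range_succ', level_zero]
  simp only [level_image]

lemma levelDist_triangle (n : ℕ) (x y z : ℕ → V → ℝ) :
    levelDist par A n x z ≤ levelDist par A n x y + levelDist par A n y z := by
  unfold levelDist
  rw [← Finset.sum_add_distrib]
  refine Finset.sum_le_sum fun k _ => ?_
  rw [← Finset.sum_add_distrib]
  exact Finset.sum_le_sum fun v _ => abs_sub_le _ _ _

lemma levelDist_subset {A' : Finset V} (h : A' ⊆ A) (n : ℕ) {x y : ℕ → V → ℝ}
    (hx : ∀ k, ∀ v ∉ level par A' k, x k v = 0) (hy : ∀ k, ∀ v ∉ level par A' k, y k v = 0) :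
    levelDist par A n x y = levelDist par A' n x y := by
  unfold levelDist
  refine Finset.sum_congr rfl fun k _ => ?_
  refine (Finset.sum_subset (level_mono h k) fun v _ hv => ?_).symm
  rw [hx k v hv, hy k v hv, sub_self, abs_zero]

lemma level_eq_singleton {A' : Finset V} (h : A' ⊆ A) (hne : A'.Nonempty) {n : ℕ} {r : V}
    (hr : level par A n = {r}) : level par A' n = {r} :=
  (Finset.subset_singleton_iff.1 (hr ▸ level_mono h n)).resolve_left
    (level_nonempty hne n).ne_empty

variable (par) in
/-- The potential which pays for deletions. -/
def potential (w : ℕ) (A : Finset V) (n : ℕ) (r : V) : ℝ :=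
  2 * (1 + 4 * log w) * energy par A n r + 4 * log w / w * nodeCount par A n

lemma levelDist_delete {A' : Finset V} (h : A' ⊆ A) (hne : A'.Nonempty) {n : ℕ} {r : V}
    (hr : level par A n = {r}) {w : ℕ} (hw : A.card ≤ w) :
    levelDist par A n (mass par A n) (mass par A' n) ≤
      potential par w A n r - potential par w A' n r := by
  induction A using Finset.strongInduction with
  | H A ih =>
    by_cases hc : A ⊆ A'
    · rw [Finset.Subset.antisymm hc h]
      simp [levelDist]
    · obtain ⟨l, hl, hl'⟩ := Finset.not_subset.1 hc
      have hsub : A' ⊆ A.erase l := Finset.subset_erase.2 ⟨h, hl'⟩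
      have h1 := ih _ (Finset.erase_ssubset hl) hsub
        (level_eq_singleton (Finset.erase_subset _ _) (hne.mono hsub) hr)
        ((Finset.card_le_card (Finset.erase_subset _ _)).trans hw)
      have h2 := levelDist_erase hl hr (hne.mono hsub) hw
      have h3 := levelDist_triangle (par := par) (A := A) n (mass par A n)
        (mass par (A.erase l) n) (mass par A' n)
      rw [levelDist_subset (Finset.erase_subset l A) n (x := mass par (A.erase l) n)
        (fun k v hv => mass_of_notMem hv)
        (fun k v hv => mass_of_notMem fun hv' => hv (level_mono hsub k hv'))] at h3
      unfold potential at h1 ⊢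
      linarith

lemma potential_nonneg {w : ℕ} {n : ℕ} {r : V} (hr : r ∈ level par A n) (hw : 1 ≤ w) :
    0 ≤ potential par w A n r := by
  have h1 : 0 ≤ log (w : ℝ) := log_nonneg (by exact_mod_cast hw)
  have h2 := energy_nonneg n hr
  unfold potential
  positivity

/-- The constant of competitiveness. -/
def ratio (w : ℕ) : ℝ := 3 + 10 * log w + 12 * log w ^ 2

/-- The amortized movement in one step of the algorithm. -/
lemma levelDist_step (h : B.image par ⊆ A) (hB : B.Nonempty) {n : ℕ} {r : V}
    (hr : level par A n = {r}) {w : ℕ} (hA : A.card ≤ w) (hw : B.card ≤ w) :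
    levelDist par A n (mass par A n) (fun k => mass par B (n + 1) (k + 1)) ≤
      ratio w - 1 + potential par w A n r - potential par w B (n + 1) r := by
  have hne : (B.image par).Nonempty := hB.image par
  have hr' := level_eq_singleton h hne hr
  have hr'' : r ∈ level par (B.image par) n := by simp [hr']
  have h1 := levelDist_delete h hne hr hA
  have h2 := levelDist_extend hw hB hr'
  have h3 := levelDist_triangle (par := par) (A := A) n (mass par A n)
    (mass par (B.image par) n) (fun k => mass par B (n + 1) (k + 1))
  rw [levelDist_subset h n (x := mass par (B.image par) n) (fun k v hv => mass_of_notMem hv)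
    (fun k v hv => mass_of_notMem (by rwa [level_image] at hv))] at h3
  have h4 := energy_extend_le hw n hr''
  have hw1 : (1 : ℝ) ≤ w := by exact_mod_cast hB.card_pos.trans_le hw
  have hL : 0 ≤ log w := log_nonneg hw1
  have h5 : 4 * log w / w * B.card ≤ 4 * log w := by
    calc 4 * log w / w * B.card ≤ 4 * log w / w * w :=
          mul_le_mul_of_nonneg_left (by exact_mod_cast hw) (by positivity)
      _ = 4 * log w := by field_simp
  have h6 := mul_le_mul_of_nonneg_left h4 (show 0 ≤ 2 * (1 + 4 * log w) by positivity)
  unfold potential ratio at *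
  rw [nodeCount_succ]
  push_cast
  nlinarith

end Extend

end Leveled

/-! ### The minimizer of the regularizer -/

namespace Leveled

open Classical Real

variable {V : Type u} {par : V → V} {A : Finset V}

lemma sum_level_mul_par {n k : ℕ} (hk : k < n) {y : V → ℝ}
    (hy : ∀ k < n, ∀ u ∈ level par A (k + 1), y u = ∑ v ∈ children par A k u, y v) (g : V → ℝ) :
    ∑ v ∈ level par A k, y v * g (par v) = ∑ u ∈ level par A (k + 1), y u * g u := by
  rw [sum_level]
  refine Finset.sum_congr rfl fun u hu => ?_
  rw [hy k hk u hu, Finset.sum_mul]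
  exact Finset.sum_congr rfl fun v hv => by rw [(mem_children.1 hv).2]

lemma sum_level_flow {n : ℕ} {r : V} (hr : level par A n = {r}) {y : V → ℝ}
    (hy : ∀ k < n, ∀ u ∈ level par A (k + 1), y u = ∑ v ∈ children par A k u, y v)
    {k : ℕ} (hk : k ≤ n) : ∑ v ∈ level par A k, y v = y r := by
  induction hk using Nat.decreasingInduction with
  | self => rw [hr, Finset.sum_singleton]
  | of_succ k hk ih =>
    rw [← ih]
    simpa using sum_level_mul_par hk hy (fun _ => 1)

/-- The linearization of the regularizer at the entropic configuration is constant on the active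
polytope: this is its optimality condition. -/
lemma sum_mul_log_mass {n : ℕ} {r : V} (hr : level par A n = {r}) {y : V → ℝ}
    (hy : ∀ k < n, ∀ u ∈ level par A (k + 1), y u = ∑ v ∈ children par A k u, y v) :
    ∑ k ∈ Finset.range (n + 1), ∑ v ∈ level par A k, y v * log (mass par A n k v) =
      -(y r * energy par A n r) := by
  set W : ℕ → ℝ := fun k => ∑ v ∈ level par A k, y v * log (mass par A n k v) with hW
  set e : ℕ → ℝ := fun k => ∑ v ∈ level par A k, y v * energy par A k v with he
  have hstep : ∀ k < n, W k = W (k + 1) + (e k - e (k + 1)) / (k + 1) := by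
    intro k hk
    simp only [hW, he]
    rw [← sum_level_mul_par hk hy (fun u => log (mass par A n (k + 1) u)),
      ← sum_level_mul_par hk hy (fun u => energy par A (k + 1) u), ← Finset.sum_sub_distrib,
      Finset.sum_div, ← Finset.sum_add_distrib]
    refine Finset.sum_congr rfl fun v hv => ?_
    rw [mass_step hk hv, log_mul (trans_pos _ _).ne' (mass_pos (par_mem_level hv)).ne', trans,
      log_exp]
    ring
  have hsum : ∀ m ≤ n, ∑ k ∈ Finset.range m, W k = m * W m + e 0 - e m := by
    intro m
    induction m with
    | zero => intro _; simp
    | succ m ih =>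
      intro hm
      rw [Finset.sum_range_succ, ih (by omega), hstep m hm]
      push_cast
      field_simp
      ring
  have hrn : r ∈ level par A n := by simp [hr]
  change ∑ k ∈ Finset.range (n + 1), W k = _
  rw [Finset.sum_range_succ, hsum n le_rfl]
  have h1 : W n = 0 := by simp [hW, hr, mass_self hrn]
  have h2 : e 0 = 0 := by simp [he, energy]
  have h3 : e n = y r * energy par A n r := by simp [he, hr]
  rw [h1, h2, h3]
  ring

end Leveled

namespace LayeredTree

open Classical Leveled

variable {V : Type u} (T : LayeredTree V) {par : V → V}

/-- The map `par` gives the parents of the nodes of `T` other than the root. -/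
def IsParentMap (par : V → V) : Prop := ∀ s, ∀ v ∈ T.layer (s + 1), T.parent v = some (par v)

lemma isParentMap_getD : T.IsParentMap fun v => (T.parent v).getD v := by
  intro s v hv
  obtain ⟨u, _, hu⟩ := T.parent_of_mem s v hv
  simp [hu]

variable {T}

lemma layer_unique {s t : ℕ} {v : V} (hs : v ∈ T.layer s) (ht : v ∈ T.layer t) : s = t := by
  by_contra h
  exact Finset.disjoint_left.1 (T.layer_disjoint s t h) hs ht

lemma IsParentMap.par_mem (h : T.IsParentMap par) {s : ℕ} {v : V} (hv : v ∈ T.layer (s + 1)) :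
    par v ∈ T.layer s := by
  obtain ⟨u, hu, hp⟩ := T.parent_of_mem s v hv
  rw [h s v hv, Option.some.injEq] at hp
  rwa [hp]

lemma IsParentMap.iterate_mem (h : T.IsParentMap par) {l : V} (hl : l ∈ T.lastLayer) {k : ℕ}
    (hk : k ≤ T.height) : par^[k] l ∈ T.layer (T.height - k) := by
  induction k with
  | zero => exact hl
  | succ k ih =>
    rw [Function.iterate_succ_apply']
    apply h.par_mem
    rw [show T.height - (k + 1) + 1 = T.height - k by omega]
    exact ih (by omega)

lemma IsParentMap.level_subset (h : T.IsParentMap par) {k : ℕ} (hk : k ≤ T.height) :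
    level par T.lastLayer k ⊆ T.layer (T.height - k) := by
  intro v hv
  obtain ⟨l, hl, rfl⟩ := Finset.mem_image.1 hv
  exact h.iterate_mem hl hk

lemma IsParentMap.level_height (h : T.IsParentMap par) (hT : T.lastLayer.Nonempty) :
    level par T.lastLayer T.height = {T.root} := by
  have h1 := h.level_subset le_rfl
  rw [Nat.sub_self, T.layer_zero] at h1
  exact (Finset.subset_singleton_iff.1 h1).resolve_left (level_nonempty hT _).ne_empty

lemma IsParentMap.level_unique (h : T.IsParentMap par) {j k : ℕ} (hj : j ≤ T.height)
    (hk : k ≤ T.height) {v : V} (hvj : v ∈ level par T.lastLayer j)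
    (hvk : v ∈ level par T.lastLayer k) : j = k := by
  have := layer_unique (h.level_subset hj hvj) (h.level_subset hk hvk)
  omega

lemma IsParentMap.parent_of_mem_level (h : T.IsParentMap par) {k : ℕ} (hk : k < T.height) {v : V}
    (hv : v ∈ level par T.lastLayer k) : T.parent v = some (par v) := by
  have h1 := h.level_subset hk.le hv
  rw [show T.height - k = T.height - k - 1 + 1 by omega] at h1
  exact h _ v h1

lemma IsParentMap.mem_activeNodes (h : T.IsParentMap par) {u : V} :
    u ∈ T.activeNodes ↔ ∃ k ≤ T.height, u ∈ level par T.lastLayer k := by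
  simp only [activeNodes, Finset.mem_filter]
  constructor
  · rintro ⟨-, l, hl, hu⟩
    induction hu using Relation.ReflTransGen.head_induction_on with
    | refl => exact ⟨0, Nat.zero_le _, by rwa [level_zero]⟩
    | head hab _ ih =>
      obtain ⟨k, hk, hv⟩ := ih
      rcases hk.eq_or_lt with rfl | hk
      · rw [h.level_height ⟨l, hl⟩, Finset.mem_singleton] at hv
        rw [hv, T.parent_root] at hab
        cases hab
      · rw [h.parent_of_mem_level hk hv, Option.some.injEq] at hab
        exact ⟨k + 1, hk, hab ▸ par_mem_level hv⟩
  · rintro ⟨k, hk, hu⟩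
    refine ⟨Finset.mem_biUnion.2 ⟨T.height - k, Finset.mem_range.2 (by omega),
      h.level_subset hk hu⟩, ?_⟩
    obtain ⟨l, hl, rfl⟩ := Finset.mem_image.1 hu
    refine ⟨l, hl, ?_⟩
    clear hu
    induction k with
    | zero => exact Relation.ReflTransGen.refl
    | succ k ih =>
      refine Relation.ReflTransGen.head ?_ (ih (by omega))
      rw [Function.iterate_succ_apply']
      exact h.parent_of_mem_level (by omega) (Finset.mem_image_of_mem _ hl)

lemma IsParentMap.activeChildren_eq (h : T.IsParentMap par) {k : ℕ} (hk : k < T.height) {u : V}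
    (hu : u ∈ level par T.lastLayer (k + 1)) :
    T.activeChildren u = children par T.lastLayer k u := by
  ext v
  simp only [activeChildren, Finset.mem_filter, mem_children]
  constructor
  · rintro ⟨hv, hp⟩
    obtain ⟨j, hj, hv⟩ := h.mem_activeNodes.1 hv
    rcases hj.eq_or_lt with rfl | hj
    · have hT : T.lastLayer.Nonempty := Finset.image_nonempty.1 ⟨v, hv⟩
      rw [h.level_height hT, Finset.mem_singleton] at hv
      rw [hv, T.parent_root] at hp
      cases hp
    · rw [h.parent_of_mem_level hj hv, Option.some.injEq] at hp
      have := h.level_unique hj hk (par_mem_level hv) (hp ▸ hu)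
      obtain rfl : j = k := by omega
      exact ⟨hv, hp⟩
  · rintro ⟨hv, rfl⟩
    exact ⟨h.mem_activeNodes.2 ⟨k, hk.le, hv⟩, h.parent_of_mem_level hk hv⟩

lemma IsParentMap.activeNodes_eq (h : T.IsParentMap par) :
    T.activeNodes = (Finset.range (T.height + 1)).biUnion (level par T.lastLayer) := by
  ext u
  simp [h.mem_activeNodes]

lemma IsParentMap.sum_activeNodes (h : T.IsParentMap par) (f : V → ℝ) :
    ∑ u ∈ T.activeNodes, f u =
      ∑ k ∈ Finset.range (T.height + 1), ∑ u ∈ level par T.lastLayer k, f u := by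
  rw [h.activeNodes_eq, Finset.sum_biUnion]
  intro j hj k hk hjk
  have hj : j < T.height + 1 := Finset.mem_range.1 hj
  have hk : k < T.height + 1 := Finset.mem_range.1 hk
  exact Finset.disjoint_left.2 fun v h1 h2 =>
    hjk (h.level_unique (by omega) (by omega) h1 h2)

variable (T par) in
/-- The entropic configuration; every node has a nonzero mass at one height at most. -/
def config (u : V) : ℝ :=
  ∑ k ∈ Finset.range (T.height + 1), mass par T.lastLayer T.height k u

lemma IsParentMap.config_eq (h : T.IsParentMap par) {k : ℕ} (hk : k ≤ T.height) {u : V}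
    (hu : u ∈ level par T.lastLayer k) :
    T.config par u = mass par T.lastLayer T.height k u := by
  rw [config, Finset.sum_eq_single k]
  · intro j hj hjk
    exact mass_of_notMem fun hv =>
      hjk (h.level_unique (by have := Finset.mem_range.1 hj; omega) hk hv hu)
  · intro hk'
    exact absurd (Finset.mem_range.2 (by omega)) hk'

lemma IsParentMap.flow (h : T.IsParentMap par) {y : V → ℝ} (hy : y ∈ T.activePolytope) :
    ∀ k < T.height, ∀ u ∈ level par T.lastLayer (k + 1),
      y u = ∑ v ∈ children par T.lastLayer k u, y v := by
  intro k hk u hu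
  rw [← h.activeChildren_eq hk hu]
  refine hy.2.2 u (h.mem_activeNodes.2 ⟨k + 1, hk, hu⟩) fun hl => ?_
  have := h.level_unique hk (Nat.zero_le _) hu (by rwa [level_zero])
  omega

lemma IsParentMap.config_mem (h : T.IsParentMap par) (hT : T.lastLayer.Nonempty) :
    T.config par ∈ T.positivePolytope := by
  have hr := h.level_height hT
  have hroot : T.root ∈ level par T.lastLayer T.height := by simp [hr]
  refine ⟨⟨?_, fun u hu => ?_, fun u hu hl => ?_⟩, fun u hu => ?_⟩
  · rw [h.config_eq le_rfl hroot, mass_self hroot]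
  · refine Finset.sum_eq_zero fun k hk => mass_of_notMem fun hk' => hu ?_
    exact h.mem_activeNodes.2 ⟨k, by have := Finset.mem_range.1 hk; omega, hk'⟩
  · obtain ⟨k, hk, hu⟩ := h.mem_activeNodes.1 hu
    obtain ⟨k, rfl⟩ : ∃ j, k = j + 1 := by
      refine Nat.exists_eq_succ_of_ne_zero ?_
      rintro rfl
      exact hl (by rwa [level_zero] at hu)
    rw [h.activeChildren_eq hk hu, h.config_eq hk hu, ← sum_children_mass hk hu]
    exact Finset.sum_congr rfl fun v hv =>
      (h.config_eq (Nat.le_of_succ_le hk) (mem_children.1 hv).1).symm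
  · obtain ⟨k, hk, hu⟩ := h.mem_activeNodes.1 hu
    rw [h.config_eq hk hu]
    exact mass_pos hu

lemma IsParentMap.sum_mul_log_config (h : T.IsParentMap par) (hT : T.lastLayer.Nonempty)
    {y : V → ℝ} (hy : y ∈ T.activePolytope) :
    ∑ u ∈ T.activeNodes, y u * Real.log (T.config par u) =
      -energy par T.lastLayer T.height T.root := by
  have h1 := sum_mul_log_mass (h.level_height hT) (h.flow hy)
  rw [hy.1, one_mul] at h1
  rw [← h1, h.sum_activeNodes]
  refine Finset.sum_congr rfl fun k hk => Finset.sum_congr rfl fun u hu => ?_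
  rw [h.config_eq (by have := Finset.mem_range.1 hk; omega) hu]

lemma IsParentMap.sum_activeNodes_flow (h : T.IsParentMap par) (hT : T.lastLayer.Nonempty)
    {y : V → ℝ} (hy : y ∈ T.activePolytope) : ∑ u ∈ T.activeNodes, y u = T.height + 1 := by
  rw [h.sum_activeNodes, Finset.sum_congr rfl fun k hk => sum_level_flow (h.level_height hT)
    (h.flow hy) (by have := Finset.mem_range.1 hk; omega), hy.1]
  simp

lemma mul_log_sub_nonneg {a b : ℝ} (ha : 0 < a) (hb : 0 < b) :
    0 ≤ a * Real.log a - a * Real.log b - a + b := by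
  have h1 := Real.log_le_sub_one_of_pos (div_pos hb ha)
  rw [Real.log_div hb.ne' ha.ne'] at h1
  have h2 := mul_le_mul_of_nonneg_left h1 ha.le
  rw [mul_sub, mul_sub, mul_div_cancel₀ _ ha.ne'] at h2
  linarith

lemma eq_of_mul_log_sub_eq_zero {a b : ℝ} (ha : 0 < a) (hb : 0 < b)
    (h : a * Real.log a - a * Real.log b - a + b = 0) : a = b := by
  by_contra hab
  have h1 := Real.log_lt_sub_one_of_pos (div_pos hb ha)
    (fun h => hab ((div_eq_one_iff_eq ha.ne').1 h).symm)
  rw [Real.log_div hb.ne' ha.ne'] at h1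
  have h2 := mul_lt_mul_of_pos_left h1 ha
  rw [mul_sub, mul_sub, mul_div_cancel₀ _ ha.ne'] at h2
  linarith

/-- The excess of the regularizer over its value at the entropic configuration is a relative
entropy. -/
lemma IsParentMap.regularizer_sub (h : T.IsParentMap par) (hT : T.lastLayer.Nonempty)
    {y : V → ℝ} (hy : y ∈ T.activePolytope) :
    T.regularizer y - T.regularizer (T.config par) = ∑ u ∈ T.activeNodes,
      (y u * Real.log (y u) - y u * Real.log (T.config par u) - y u + T.config par u) := by
  have hx := (h.config_mem hT).1
  rw [Finset.sum_add_distrib, Finset.sum_sub_distrib, Finset.sum_sub_distrib,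
    h.sum_mul_log_config hT hy, h.sum_activeNodes_flow hT hy, h.sum_activeNodes_flow hT hx,
    regularizer, regularizer, h.sum_mul_log_config hT hx]
  ring

lemma IsParentMap.isMinimizer_config (h : T.IsParentMap par) (hT : T.lastLayer.Nonempty) :
    T.IsMinimizer (T.config par) := by
  refine ⟨h.config_mem hT, fun y hy => sub_nonneg.1 ?_⟩
  rw [h.regularizer_sub hT hy.1]
  exact Finset.sum_nonneg fun u hu => mul_log_sub_nonneg (hy.2 u hu) ((h.config_mem hT).2 u hu)

lemma IsParentMap.eq_config (h : T.IsParentMap par) (hT : T.lastLayer.Nonempty) {y : V → ℝ}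
    (hy : T.IsMinimizer y) : y = T.config par := by
  have hx := h.config_mem hT
  have h1 := sub_nonpos.2 (hy.2 _ hx)
  have hnn : ∀ u ∈ T.activeNodes, 0 ≤
      y u * Real.log (y u) - y u * Real.log (T.config par u) - y u + T.config par u :=
    fun u hu => mul_log_sub_nonneg (hy.1.2 u hu) (hx.2 u hu)
  rw [h.regularizer_sub hT hy.1.1] at h1
  have h2 := (Finset.sum_eq_zero_iff_of_nonneg hnn).1 (le_antisymm h1 (Finset.sum_nonneg hnn))
  funext u
  by_cases hu : u ∈ T.activeNodes
  · exact eq_of_mul_log_sub_eq_zero (hy.1.2 u hu) (hx.2 u hu) (h2 u hu)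
  · rw [hy.1.1.2.1 u hu, hx.1.2.1 u hu]

theorem existsUnique_isMinimizer (hT : T.lastLayer.Nonempty) : ∃! x : V → ℝ, T.IsMinimizer x :=
  ⟨_, T.isParentMap_getD.isMinimizer_config hT, fun _ hy => T.isParentMap_getD.eq_config hT hy⟩

lemma IsParentMap.config_lastLayer (h : T.IsParentMap par) {l : V} (hl : l ∈ T.lastLayer) :
    T.config par l = mass par T.lastLayer T.height 0 l :=
  h.config_eq (Nat.zero_le _) (by rwa [level_zero])

lemma IsParentMap.sum_config (h : T.IsParentMap par) (hT : T.lastLayer.Nonempty) :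
    ∑ l ∈ T.lastLayer, T.config par l = 1 := by
  rw [← sum_mass (Nat.zero_le _) (h.level_height hT), level_zero]
  exact Finset.sum_congr rfl fun l hl => h.config_lastLayer hl

end LayeredTree

namespace Leveled

open Classical

variable {V : Type u}

/-! ### A coupling that respects the tree -/

variable (par : V → V)

/-- The total variation of the signed weights `d` on `S` and of their images under the first
`n - 1` iterates of the parent map, added up over these `n` levels. -/
def treeVariation : ℕ → Finset V → (V → ℝ) → ℝ
  | 0, _, _ => 0
  | n + 1, S, d => ∑ v ∈ S, |d v| +
      treeVariation n (S.image par) fun u => ∑ v ∈ S with par v = u, d v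

/-- The number of `k < n` for which the ancestors of `a` and `b`, `k` levels above, differ. -/
def divergence : ℕ → V → V → ℕ
  | 0, _, _ => 0
  | n + 1, a, b => (if a = b then 0 else 1) + divergence n (par a) (par b)

variable {par}

lemma divergence_self (n : ℕ) (a : V) : divergence par n a a = 0 := by
  induction n generalizing a with
  | zero => rfl
  | succ n ih => simp [divergence, ih]

lemma treeVariation_congr (n : ℕ) {S : Finset V} {d d' : V → ℝ} (h : ∀ v ∈ S, d v = d' v) :
    treeVariation par n S d = treeVariation par n S d' := by
  induction n generalizing S d d' with
  | zero => rfl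
  | succ n ih =>
    rw [treeVariation, treeVariation, Finset.sum_congr rfl fun v hv => by rw [h v hv]]
    congr 1
    exact ih fun u _ => Finset.sum_congr rfl fun v hv => h v (Finset.mem_filter.1 hv).1

lemma treeVariation_level {A : Finset V} {N : ℕ} {d : ℕ → V → ℝ}
    (hd : ∀ k < N, ∀ u ∈ level par A (k + 1), d (k + 1) u = ∑ v ∈ children par A k u, d k v)
    (n k : ℕ) (h : k + n ≤ N) :
    treeVariation par n (level par A k) (d k) =
      ∑ j ∈ Finset.range n, ∑ v ∈ level par A (k + j), |d (k + j) v| := by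
  induction n generalizing k with
  | zero => simp [treeVariation]
  | succ n ih =>
    rw [treeVariation, Finset.sum_range_succ', add_comm, ← level_succ]
    change treeVariation par n _ (fun u => ∑ v ∈ children par A k u, d k v) + _ = _
    rw [treeVariation_congr n (d' := d (k + 1)) fun u hu => (hd k (by omega) u hu).symm,
      ih (k + 1) (by omega)]
    simp only [add_zero, add_assoc, add_comm 1]

/-- A coupling of the images of two weight functions under `φ` and `ψ` lifts to a coupling of the
weight functions themselves. -/
lemma exists_lift_coupling {S S' U U' : Finset V} {φ ψ : V → V} (hφ : ∀ a ∈ S, φ a ∈ U)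
    (hψ : ∀ b ∈ S', ψ b ∈ U') {f g : V → ℝ} (hf : ∀ a, 0 ≤ f a) (hg : ∀ b, 0 ≤ g b)
    {w : V → V → ℝ} (hw : ∀ a b, 0 ≤ w a b)
    (hrow : ∀ u ∈ U, ∑ u' ∈ U', w u u' = ∑ a ∈ S with φ a = u, f a)
    (hcol : ∀ u' ∈ U', ∑ u ∈ U, w u u' = ∑ b ∈ S' with ψ b = u', g b) :
    ∃ w' : V → V → ℝ, (∀ a b, 0 ≤ w' a b) ∧ (∀ a ∈ S, ∑ b ∈ S', w' a b = f a) ∧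
      (∀ b ∈ S', ∑ a ∈ S, w' a b = g b) ∧ ∀ c : V → V → ℝ,
      ∑ a ∈ S, ∑ b ∈ S', w' a b * c (φ a) (ψ b) = ∑ u ∈ U, ∑ u' ∈ U', w u u' * c u u' := by
  set F : V → ℝ := fun u => ∑ a ∈ S with φ a = u, f a with hF
  set G : V → ℝ := fun u => ∑ b ∈ S' with ψ b = u, g b with hG
  have hF0 : ∀ u, 0 ≤ F u := fun u => Finset.sum_nonneg fun a _ => hf a
  have hG0 : ∀ u, 0 ≤ G u := fun u => Finset.sum_nonneg fun a _ => hg a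
  -- conditional weights add up to one on each fibre that carries some weight
  have hα : ∀ u, ∀ x : ℝ, (F u = 0 → x = 0) →
      x * ∑ a ∈ S with φ a = u, f a / F (φ a) = x := by
    intro u x hx
    have : ∑ a ∈ S with φ a = u, f a / F (φ a) = F u / F u := by
      rw [Finset.sum_congr rfl fun a ha => by rw [(Finset.mem_filter.1 ha).2], ← Finset.sum_div]
    rw [this]
    by_cases h : F u = 0
    · simp [hx h]
    · rw [div_self h, mul_one]
  have hβ : ∀ u, ∀ x : ℝ, (G u = 0 → x = 0) →
      x * ∑ b ∈ S' with ψ b = u, g b / G (ψ b) = x := by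
    intro u x hx
    have : ∑ a ∈ S' with ψ a = u, g a / G (ψ a) = G u / G u := by
      rw [Finset.sum_congr rfl fun a ha => by rw [(Finset.mem_filter.1 ha).2], ← Finset.sum_div]
    rw [this]
    by_cases h : G u = 0
    · simp [hx h]
    · rw [div_self h, mul_one]
  have hwF : ∀ u ∈ U, ∀ u' ∈ U', F u = 0 → w u u' = 0 := fun u hu u' hu' h =>
    (Finset.sum_eq_zero_iff_of_nonneg fun b _ => hw u b).1 ((hrow u hu).trans h) u' hu'
  have hwG : ∀ u ∈ U, ∀ u' ∈ U', G u' = 0 → w u u' = 0 := fun u hu u' hu' h =>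
    (Finset.sum_eq_zero_iff_of_nonneg fun b _ => hw b u').1 ((hcol u' hu').trans h) u hu
  have hfF : ∀ a ∈ S, F (φ a) = 0 → f a = 0 := fun a ha h =>
    (Finset.sum_eq_zero_iff_of_nonneg fun b _ => hf b).1 h a (by simp [ha])
  have hgG : ∀ b ∈ S', G (ψ b) = 0 → g b = 0 := fun b hb h =>
    (Finset.sum_eq_zero_iff_of_nonneg fun b _ => hg b).1 h b (by simp [hb])
  have hsumb : ∀ u ∈ U, ∀ c : V → ℝ,
      ∑ b ∈ S', w u (ψ b) * c (ψ b) * (g b / G (ψ b)) = ∑ u' ∈ U', w u u' * c u' := by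
    intro u hu c
    rw [← Finset.sum_fiberwise_of_maps_to hψ]
    refine Finset.sum_congr rfl fun u' hu' => ?_
    rw [← hβ u' (w u u' * c u') fun h => by rw [hwG u hu u' hu' h, zero_mul], Finset.mul_sum]
    exact Finset.sum_congr rfl fun b hb => by rw [(Finset.mem_filter.1 hb).2]
  refine ⟨fun a b => w (φ a) (ψ b) * (f a / F (φ a)) * (g b / G (ψ b)), fun a b => ?_,
    fun a ha => ?_, fun b hb => ?_, fun c => ?_⟩
  · exact mul_nonneg (mul_nonneg (hw _ _) (div_nonneg (hf _) (hF0 _))) (div_nonneg (hg _) (hG0 _))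
  · have h1 := hsumb (φ a) (hφ a ha) fun _ => f a / F (φ a)
    rw [h1, ← Finset.sum_mul, hrow _ (hφ a ha)]
    exact mul_div_cancel_of_imp' (hfF a ha)
  · rw [← Finset.sum_mul, ← Finset.sum_fiberwise_of_maps_to hφ]
    have h1 : ∀ u ∈ U, ∑ a ∈ S with φ a = u, w (φ a) (ψ b) * (f a / F (φ a)) = w u (ψ b) := by
      intro u hu
      rw [← hα u (w u (ψ b)) (hwF u hu _ (hψ b hb)), Finset.mul_sum]
      refine Finset.sum_congr rfl fun a ha => ?_
      rw [(Finset.mem_filter.1 ha).2]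
    rw [Finset.sum_congr rfl h1, hcol _ (hψ b hb)]
    exact mul_div_cancel_of_imp' (hgG b hb)
  · rw [← Finset.sum_fiberwise_of_maps_to hφ]
    refine Finset.sum_congr rfl fun u hu => ?_
    rw [← hα u (∑ u' ∈ U', w u u' * c u u') fun h =>
      Finset.sum_eq_zero fun u' hu' => by rw [hwF u hu u' hu' h, zero_mul], Finset.mul_sum]
    refine Finset.sum_congr rfl fun a ha => ?_
    beta_reduce
    rw [(Finset.mem_filter.1 ha).2, ← hsumb u hu (c u), Finset.sum_mul]
    exact Finset.sum_congr rfl fun b _ => by ring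

/-- Matching as much mass as possible at each node, and passing the rest on to the parents, couples
two weight functions at a cost bounded by their variation along the tree. -/
lemma exists_coupling (n : ℕ) (S : Finset V) {f g : V → ℝ} (hf : ∀ a, 0 ≤ f a)
    (hg : ∀ b, 0 ≤ g b) (hfg : ∑ a ∈ S, f a = ∑ b ∈ S, g b) :
    ∃ w : V → V → ℝ, (∀ a b, 0 ≤ w a b) ∧ (∀ a ∈ S, ∑ b ∈ S, w a b = f a) ∧
      (∀ b ∈ S, ∑ a ∈ S, w a b = g b) ∧
      2 * ∑ a ∈ S, ∑ b ∈ S, w a b * divergence par n a b ≤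
        treeVariation par n S fun v => f v - g v := by
  induction n generalizing S f g with
  | zero =>
    have hf0 : ∀ a ∈ S, ∑ a ∈ S, f a = 0 → f a = 0 := fun a ha h =>
      (Finset.sum_eq_zero_iff_of_nonneg fun a _ => hf a).1 h a ha
    have hg0 : ∀ a ∈ S, ∑ a ∈ S, g a = 0 → g a = 0 := fun a ha h =>
      (Finset.sum_eq_zero_iff_of_nonneg fun a _ => hg a).1 h a ha
    refine ⟨fun a b => f a * g b / ∑ a ∈ S, f a, fun a b => ?_, fun a ha => ?_, fun b hb => ?_,
      by simp [divergence, treeVariation]⟩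
    · exact div_nonneg (mul_nonneg (hf a) (hg b)) (Finset.sum_nonneg fun a _ => hf a)
    · rw [← Finset.sum_div, ← Finset.mul_sum, ← hfg]
      exact mul_div_cancel_of_imp (hf0 a ha)
    · rw [← Finset.sum_div, ← Finset.sum_mul, hfg]
      exact mul_div_cancel_left_of_imp (hg0 b hb)
  | succ n ih =>
    set m : V → ℝ := fun v => min (f v) (g v) with hm
    have hm0 : ∀ v, 0 ≤ m v := fun v => le_min (hf v) (hg v)
    have hf' : ∀ v, 0 ≤ f v - m v := fun v => sub_nonneg.2 (min_le_left _ _)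
    have hg' : ∀ v, 0 ≤ g v - m v := fun v => sub_nonneg.2 (min_le_right _ _)
    have hmap : ∀ a ∈ S, par a ∈ S.image par := fun a ha => Finset.mem_image_of_mem _ ha
    obtain ⟨w₁, hw₁, hrow₁, hcol₁, hcost₁⟩ := ih (S.image par)
      (f := fun u => ∑ v ∈ S with par v = u, (f v - m v))
      (g := fun u => ∑ v ∈ S with par v = u, (g v - m v))
      (fun u => Finset.sum_nonneg fun v _ => hf' v)
      (fun u => Finset.sum_nonneg fun v _ => hg' v)
      (by
        rw [Finset.sum_fiberwise_of_maps_to hmap, Finset.sum_fiberwise_of_maps_to hmap,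
          Finset.sum_sub_distrib, Finset.sum_sub_distrib, hfg])
    obtain ⟨w₂, hw₂, hrow₂, hcol₂, hcost₂⟩ :=
      exists_lift_coupling hmap hmap hf' hg' hw₁ hrow₁ hcol₁
    refine ⟨fun a b => (if a = b then m a else 0) + w₂ a b, fun a b => ?_, fun a ha => ?_,
      fun b hb => ?_, ?_⟩
    · exact add_nonneg (by split_ifs <;> simp [hm0]) (hw₂ a b)
    · rw [Finset.sum_add_distrib, hrow₂ a ha, Finset.sum_ite_eq, if_pos ha]
      ring
    · rw [Finset.sum_add_distrib, hcol₂ b hb, Finset.sum_ite_eq', if_pos hb]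
      ring
    · have h1 : ∀ a ∈ S, ∀ b ∈ S,
          ((if a = b then m a else 0) + w₂ a b) * (divergence par (n + 1) a b : ℝ) ≤
          w₂ a b + w₂ a b * (divergence par n (par a) (par b) : ℝ) := by
        intro a _ b _
        by_cases hab : a = b
        · subst hab
          rw [divergence_self, divergence_self]
          simpa using hw₂ a a
        · rw [divergence, if_neg hab, if_neg hab]
          push_cast
          linarith
      have h2 := Finset.sum_le_sum fun a ha => Finset.sum_le_sum (h1 a ha)
      simp only [Finset.sum_add_distrib] at h2
      rw [hcost₂ fun u u' => (divergence par n u u' : ℝ), Finset.sum_congr rfl hrow₂] at h2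
      have h3 : 2 * ∑ a ∈ S, (f a - m a) = ∑ a ∈ S, |f a - g a| := by
        have e1 : ∑ a ∈ S, (f a - m a) = ∑ a ∈ S, (g a - m a) := by
          rw [Finset.sum_sub_distrib, Finset.sum_sub_distrib, hfg]
        rw [two_mul]
        nth_rewrite 2 [e1]
        rw [← Finset.sum_add_distrib]
        refine Finset.sum_congr rfl fun a _ => ?_
        rcases le_total (f a) (g a) with h | h
        · simp only [hm, min_eq_left h]
          rw [abs_of_nonpos (by linarith)]; ring
        · simp only [hm, min_eq_right h]
          rw [abs_of_nonneg (by linarith)]; ring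
      have h4 : (fun u => ∑ v ∈ S with par v = u, (f v - m v) -
          ∑ v ∈ S with par v = u, (g v - m v)) = fun u => ∑ v ∈ S with par v = u, (f v - g v) := by
        funext u
        rw [← Finset.sum_sub_distrib]
        exact Finset.sum_congr rfl fun v _ => by ring
      rw [h4] at hcost₁
      rw [treeVariation]
      linarith

/-- A coupling of the entropic distributions on two consecutive layers. -/
lemma exists_coupling_mass {A B : Finset V} (h : B.image par ⊆ A) (hB : B.Nonempty) {n : ℕ} {r : V}
    (hr : level par A n = {r}) :
    ∃ w : V → V → ℝ, (∀ a b, 0 ≤ w a b) ∧ (∀ a ∈ A, ∑ b ∈ B, w a b = mass par A n 0 a) ∧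
      (∀ b ∈ B, ∑ a ∈ A, w a b = mass par B (n + 1) 0 b) ∧
      2 * ∑ a ∈ A, ∑ b ∈ B, w a b * divergence par n a (par b) ≤
        levelDist par A n (mass par A n) (fun k => mass par B (n + 1) (k + 1)) := by
  have hr' : level par B (n + 1) = {r} := by
    rw [← level_image]; exact level_eq_singleton h (hB.image par) hr
  have hsum : ∑ a ∈ A, mass par A n 0 a = ∑ b ∈ A, mass par B (n + 1) 1 b := by
    have h1 := sum_mass (Nat.zero_le _) hr
    have h2 := sum_mass (show 1 ≤ n + 1 by omega) hr'
    rw [level_zero] at h1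
    rw [h1, ← h2, show level par B 1 = B.image par by rw [← level_image, level_zero]]
    refine Finset.sum_subset h fun v _ hv => mass_of_notMem ?_
    rwa [← level_image, level_zero]
  obtain ⟨w, hw, hrow, hcol, hcost⟩ := exists_coupling (par := par) n A
    (fun a => mass_nonneg n 0 a) (fun b => mass_nonneg (n + 1) 1 b) hsum
  have hfib : ∀ u, ∑ b ∈ B with par b = u, mass par B (n + 1) 0 b = mass par B (n + 1) 1 u := by
    intro u
    by_cases hu : u ∈ level par B 1
    · rw [← sum_children_mass (by omega) hu, children, level_zero]
    · rw [mass_of_notMem hu]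
      refine Finset.sum_eq_zero fun b hb => absurd ?_ hu
      obtain ⟨hb, rfl⟩ := Finset.mem_filter.1 hb
      exact par_mem_level (by rwa [level_zero])
  obtain ⟨w', hw', hrow', hcol', hcost'⟩ := exists_lift_coupling (S := A) (S' := B) (U := A)
    (U' := A) (φ := id) (ψ := par) (f := mass par A n 0) (g := mass par B (n + 1) 0)
    (fun a ha => ha) (fun b hb => h (Finset.mem_image_of_mem _ hb)) (mass_nonneg n 0)
    (mass_nonneg (n + 1) 0) hw
    (fun u hu => by
      rw [hrow u hu]
      symm
      refine Finset.sum_eq_single_of_mem u (Finset.mem_filter.2 ⟨hu, rfl⟩) fun b hb hne => ?_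
      exact absurd (Finset.mem_filter.1 hb).2 hne)
    (fun u hu => by rw [hcol u hu, hfib])
  refine ⟨w', hw', hrow', hcol', ?_⟩
  have h1 := hcost' fun u u' => (divergence par n u u' : ℝ)
  simp only [id] at h1
  rw [h1]
  refine hcost.trans ?_
  have h2 := treeVariation_level (par := par) (A := A) (N := n)
    (d := fun k v => mass par A n k v - mass par B (n + 1) (k + 1) v) (fun k hk u hu => by
      rw [Finset.sum_sub_distrib, sum_children_mass hk hu]
      congr 1
      by_cases hu' : u ∈ level par B (k + 1 + 1)
      · rw [← sum_children_mass (by omega) hu']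
        refine Finset.sum_subset (fun v hv => ?_) fun v hv hv' => mass_of_notMem fun hv'' =>
          hv' (mem_children.2 ⟨hv'', (mem_children.1 hv).2⟩)
        obtain ⟨h1, h2⟩ := mem_children.1 hv
        rw [← level_image] at h1
        exact mem_children.2 ⟨level_mono h k h1, h2⟩
      · rw [mass_of_notMem hu']
        refine (Finset.sum_eq_zero fun v hv => mass_of_notMem fun hv' => hu' ?_).symm
        rw [← (mem_children.1 hv).2]
        exact par_mem_level hv') n 0 (by omega)
  rw [level_zero] at h2
  rw [h2, levelDist, Finset.sum_range_succ]
  simp only [zero_add]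
  exact le_add_of_nonneg_right (Finset.sum_nonneg fun _ _ => abs_nonneg _)

end Leveled

namespace LayeredTree

open Leveled

variable {V : Type u} {T : LayeredTree V} {par : V → V}

lemma IsParentMap.adj (h : T.IsParentMap par) {s : ℕ} {v : V} (hv : v ∈ T.layer (s + 1)) :
    T.graph.Adj v (par v) := by
  rw [graph, SimpleGraph.fromRel_adj]
  refine ⟨fun heq => ?_, Or.inl (h s v hv)⟩
  have hp := h.par_mem hv
  rw [← heq] at hp
  have := layer_unique hv hp
  omega

lemma IsParentMap.exists_walk (h : T.IsParentMap par) (s : ℕ) {a b : V} (ha : a ∈ T.layer s)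
    (hb : b ∈ T.layer s) : ∃ p : T.graph.Walk a b, p.length ≤ 2 * divergence par s a b := by
  induction s generalizing a b with
  | zero =>
    rw [T.layer_zero, Finset.mem_singleton] at ha hb
    subst ha
    subst hb
    exact ⟨.nil, by simp⟩
  | succ s ih =>
    by_cases hab : a = b
    · subst hab
      exact ⟨.nil, by simp⟩
    · obtain ⟨p, hp⟩ := ih (h.par_mem ha) (h.par_mem hb)
      refine ⟨.cons (h.adj ha) (p.concat (h.adj hb).symm), ?_⟩
      rw [divergence, if_neg hab]
      simp only [SimpleGraph.Walk.length_cons, SimpleGraph.Walk.length_concat]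
      omega

lemma IsParentMap.dist_le (h : T.IsParentMap par) {s : ℕ} {a b : V} (ha : a ∈ T.layer s)
    (hb : b ∈ T.layer (s + 1)) : T.dist a b ≤ 1 + 2 * divergence par s a (par b) := by
  obtain ⟨p, hp⟩ := h.exists_walk s ha (h.par_mem hb)
  have := SimpleGraph.dist_le (p.concat (h.adj hb).symm)
  rw [SimpleGraph.Walk.length_concat] at this
  unfold dist
  omega

end LayeredTree

/-! ### Optimal transport -/

section Transport

open Classical

variable {V : Type u}

lemma map_fst_apply (π : PMF (V × V)) (a : V) : π.map Prod.fst a = ∑' b, π (a, b) := by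
  rw [PMF.map_apply, ENNReal.tsum_prod', tsum_eq_single a]
  · simp
  · intro c hc
    simp [hc.symm]

lemma map_snd_apply (π : PMF (V × V)) (b : V) : π.map Prod.snd b = ∑' a, π (a, b) := by
  rw [PMF.map_apply, ENNReal.tsum_prod']
  refine tsum_congr fun a => ?_
  rw [tsum_eq_single b]
  · simp
  · intro c hc
    simp [hc.symm]

lemma isCoupling_iff {π : PMF (V × V)} {μ ν : PMF V} :
    IsCoupling π μ ν ↔ (∀ a, ∑' b, π (a, b) = μ a) ∧ ∀ b, ∑' a, π (a, b) = ν b := by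
  simp only [IsCoupling, PMF.ext_iff, map_fst_apply, map_snd_apply]

/-- Joint weights on `A ×ˢ B` with the right marginal sums there. -/
def IsCouplingOn (A B : Finset V) (μ ν : V → ℝ≥0∞) (ρ : V × V → ℝ≥0∞) : Prop :=
  (∀ z ∉ A ×ˢ B, ρ z = 0) ∧ (∀ a ∈ A, ∑ b ∈ B, ρ (a, b) = μ a) ∧
    ∀ b ∈ B, ∑ a ∈ A, ρ (a, b) = ν b

variable {μ ν : PMF V} {A B : Finset V}

lemma sum_eq_one_of_support_subset (hμ : μ.support ⊆ A) : ∑ a ∈ A, μ a = 1 := by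
  rw [← μ.tsum_coe, tsum_eq_sum]
  intro a ha
  by_contra h
  exact ha (hμ h)

lemma IsCouplingOn.exists_pmf (hμ : μ.support ⊆ A) (hν : ν.support ⊆ B) {ρ : V × V → ℝ≥0∞}
    (h : IsCouplingOn A B μ ν ρ) : ∃ π : PMF (V × V), IsCoupling π μ ν ∧ ∀ z, π z = ρ z := by
  obtain ⟨h0, h1, h2⟩ := h
  refine ⟨PMF.ofFinset ρ (A ×ˢ B) ?_ h0, isCoupling_iff.2 ⟨fun a => ?_, fun b => ?_⟩,
    fun z => rfl⟩
  · rw [Finset.sum_product, Finset.sum_congr rfl h1, sum_eq_one_of_support_subset hμ]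
  · simp only [PMF.ofFinset_apply]
    rw [tsum_eq_sum (s := B) fun b hb => h0 _ (by simp [hb])]
    by_cases ha : a ∈ A
    · exact h1 a ha
    · rw [Finset.sum_eq_zero fun b _ => h0 _ (by simp [ha])]
      by_contra h
      exact ha (hμ (Ne.symm h))
  · simp only [PMF.ofFinset_apply]
    rw [tsum_eq_sum (s := A) fun a ha => h0 _ (by simp [ha])]
    by_cases hb : b ∈ B
    · exact h2 b hb
    · rw [Finset.sum_eq_zero fun b _ => h0 _ (by simp [hb])]
      by_contra h
      exact hb (hν (Ne.symm h))

lemma IsCoupling.isCouplingOn (hμ : μ.support ⊆ A) (hν : ν.support ⊆ B) {π : PMF (V × V)}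
    (h : IsCoupling π μ ν) : IsCouplingOn A B μ ν π := by
  obtain ⟨h1, h2⟩ := isCoupling_iff.1 h
  have h0 : ∀ z ∉ A ×ˢ B, π z = 0 := by
    rintro ⟨a, b⟩ hz
    rw [Finset.mem_product, not_and_or] at hz
    rcases hz with ha | hb
    · have : μ a = 0 := by
        by_contra h
        exact ha (hμ h)
      exact ENNReal.tsum_eq_zero.1 ((h1 a).trans this) b
    · have : ν b = 0 := by
        by_contra h
        exact hb (hν h)
      exact ENNReal.tsum_eq_zero.1 ((h2 b).trans this) a
  refine ⟨h0, fun a _ => ?_, fun b _ => ?_⟩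
  · rw [← h1 a, tsum_eq_sum (s := B) fun b hb => h0 _ (by simp [hb])]
  · rw [← h2 b, tsum_eq_sum (s := A) fun a ha => h0 _ (by simp [ha])]

lemma IsCouplingOn.transportCost_eq {d : V → V → ℕ} {π : PMF (V × V)}
    (h : IsCouplingOn A B μ ν π) :
    transportCost d π = ∑ z ∈ A ×ˢ B, π z * (d z.1 z.2 : ℝ≥0∞) := by
  rw [transportCost, tsum_eq_sum fun z hz => by rw [h.1 z hz, zero_mul]]

/-- Couplings of finitely supported distributions form a compact set, on which the cost is
continuous. -/
lemma exists_isOptimalCoupling (d : V → V → ℕ) (hμ : μ.support ⊆ A) (hν : ν.support ⊆ B) :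
    ∃ π, IsOptimalCoupling d μ ν π := by
  have hclosed : IsClosed {ρ : V × V → ℝ≥0∞ | IsCouplingOn A B μ ν ρ} := by
    simp only [IsCouplingOn, Set.ofPred_and, Set.ofPred_forall]
    refine IsClosed.inter ?_ (IsClosed.inter ?_ ?_)
    · exact isClosed_iInter fun z => isClosed_iInter fun _ =>
        isClosed_eq (continuous_apply z) continuous_const
    · exact isClosed_iInter fun a => isClosed_iInter fun _ =>
        isClosed_eq (continuous_finsetSum _ fun b _ => continuous_apply _) continuous_const
    · exact isClosed_iInter fun b => isClosed_iInter fun _ =>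
        isClosed_eq (continuous_finsetSum _ fun b _ => continuous_apply _) continuous_const
  have hne : {ρ : V × V → ℝ≥0∞ | IsCouplingOn A B μ ν ρ}.Nonempty := by
    refine ⟨fun z => if z ∈ A ×ˢ B then μ z.1 * ν z.2 else 0, fun z hz => if_neg hz,
      fun a ha => ?_, fun b hb => ?_⟩
    · rw [Finset.sum_congr rfl fun b hb => if_pos (Finset.mk_mem_product ha hb)]
      change ∑ b ∈ B, μ a * ν b = _
      rw [← Finset.mul_sum, sum_eq_one_of_support_subset hν, mul_one]
    · rw [Finset.sum_congr rfl fun a ha => if_pos (Finset.mk_mem_product ha hb)]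
      change ∑ a ∈ A, μ a * ν b = _
      rw [← Finset.sum_mul, sum_eq_one_of_support_subset hμ, one_mul]
  have hcont : Continuous fun ρ : V × V → ℝ≥0∞ =>
      ∑ z ∈ A ×ˢ B, ρ z * (d z.1 z.2 : ℝ≥0∞) :=
    continuous_finsetSum _ fun z _ =>
      (ENNReal.continuous_mul_const (ENNReal.natCast_ne_top _)).comp (continuous_apply z)
  obtain ⟨ρ, hρ, hmin⟩ := hclosed.isCompact.exists_isMinOn hne hcont.continuousOn
  obtain ⟨π, hπ, hπρ⟩ := IsCouplingOn.exists_pmf hμ hν hρ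
  refine ⟨π, hπ, le_antisymm (le_iInf₂ fun π' hπ' => ?_) (iInf₂_le π hπ)⟩
  have h' := hπ'.isCouplingOn hμ hν
  rw [(hπ.isCouplingOn hμ hν).transportCost_eq, h'.transportCost_eq]
  simp only [hπρ]
  exact hmin h'

lemma optimalTransport_le_of_weights {d : V → V → ℕ} (hμ : μ.support ⊆ A) (hν : ν.support ⊆ B)
    {f g : V → ℝ} (hf : ∀ a ∈ A, μ a = ENNReal.ofReal (f a))
    (hg : ∀ b ∈ B, ν b = ENNReal.ofReal (g b)) {w : V → V → ℝ} (hw : ∀ a b, 0 ≤ w a b)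
    (hrow : ∀ a ∈ A, ∑ b ∈ B, w a b = f a) (hcol : ∀ b ∈ B, ∑ a ∈ A, w a b = g b) :
    optimalTransport d μ ν ≤ ENNReal.ofReal (∑ a ∈ A, ∑ b ∈ B, w a b * d a b) := by
  have hc : IsCouplingOn A B μ ν
      (fun z => if z ∈ A ×ˢ B then ENNReal.ofReal (w z.1 z.2) else 0) := by
    refine ⟨fun z hz => if_neg hz, fun a ha => ?_, fun b hb => ?_⟩
    · rw [Finset.sum_congr rfl fun b hb => if_pos (Finset.mk_mem_product ha hb), hf a ha,
        ← hrow a ha, ENNReal.ofReal_sum_of_nonneg fun b _ => hw a b]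
    · rw [Finset.sum_congr rfl fun a ha => if_pos (Finset.mk_mem_product ha hb), hg b hb,
        ← hcol b hb, ENNReal.ofReal_sum_of_nonneg fun a _ => hw a b]
  obtain ⟨π, hπ, hπw⟩ := hc.exists_pmf hμ hν
  refine (iInf₂_le π hπ).trans (le_of_eq ?_)
  rw [(hπ.isCouplingOn hμ hν).transportCost_eq, ← Finset.sum_product',
    ENNReal.ofReal_sum_of_nonneg fun z _ => mul_nonneg (hw _ _) (Nat.cast_nonneg _)]
  refine Finset.sum_congr rfl fun z hz => ?_
  rw [hπw, if_pos hz, ENNReal.ofReal_mul (hw _ _), ENNReal.ofReal_natCast]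

end Transport

/-! ### The fractional algorithm -/

namespace RootedGraph.ParentChoice

open Classical Leveled

variable {V : Type u} {G : RootedGraph V} (p : G.ParentChoice)

lemma tree_layer {s t : ℕ} (h : s ≤ t) : (p.tree t).layer s = G.layer s := if_pos h

lemma tree_lastLayer (t : ℕ) : (p.tree t).lastLayer = G.layer t := p.tree_layer le_rfl

lemma tree_isParentMap (t : ℕ) : (p.tree t).IsParentMap p.parent := by
  intro s v hv
  simp only [tree] at hv ⊢
  split_ifs at hv with h
  · exact if_pos (Finset.mem_biUnion.2 ⟨s, Finset.mem_range.2 h, hv⟩)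
  · simp at hv

lemma image_parent_subset (t : ℕ) : (G.layer (t + 1)).image p.parent ⊆ G.layer t := by
  intro v hv
  obtain ⟨b, hb, rfl⟩ := Finset.mem_image.1 hv
  exact p.mem_layer t b hb

lemma layer_nonempty (p : G.ParentChoice) {s t : ℕ} (hst : s ≤ t) (ht : (G.layer t).Nonempty) :
    (G.layer s).Nonempty := by
  induction hst using Nat.decreasingInduction with
  | self => exact ht
  | of_succ k _ ih => exact (ih.image p.parent).mono (p.image_parent_subset k)

lemma level_root {t : ℕ} (ht : (G.layer t).Nonempty) :
    level p.parent (G.layer t) t = {G.root} := by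
  have := (p.tree_isParentMap t).level_height (by rwa [tree_lastLayer])
  rwa [tree_lastLayer] at this

lemma truncate_tree (t : ℕ) : (p.tree (t + 1)).truncate t = p.tree t := by
  simp only [LayeredTree.truncate, tree, LayeredTree.mk.injEq, true_and]
  constructor
  · funext s
    split_ifs with h1 h2 <;> first | rfl | omega
  · funext v
    have key : ∀ s, v ∈ G.layer s → (v ∈ (Finset.range (t + 1)).biUnion (fun s =>
        if s ≤ t + 1 then G.layer s else ∅) ↔ s ≤ t) := by
      intro s hs
      simp only [Finset.mem_biUnion, Finset.mem_range]
      constructor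
      · rintro ⟨j, hj, hv⟩
        rw [if_pos (by omega)] at hv
        rw [mem_layer_iff] at hs hv
        omega
      · intro h
        exact ⟨s, by omega, by rwa [if_pos (by omega)]⟩
    have key' : ∀ n, v ∈ (Finset.range n).biUnion (fun s => G.layer (s + 1)) ↔
        ∃ s < n, v ∈ G.layer (s + 1) := by simp
    by_cases h : ∃ s, v ∈ G.layer (s + 1)
    · obtain ⟨s, hs⟩ := h
      have h1 := key _ hs
      have h2 : ∀ n, (v ∈ (Finset.range n).biUnion (fun s => G.layer (s + 1)) ↔ s < n) := by
        intro n
        rw [key']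
        refine ⟨fun ⟨j, hj, hv⟩ => ?_, fun h => ⟨s, h, hs⟩⟩
        rw [mem_layer_iff] at hs hv
        omega
      simp only [h1, h2]
      split_ifs <;> first | rfl | omega
    · have h2 : ∀ n, v ∉ (Finset.range n).biUnion (fun s => G.layer (s + 1)) := by
        intro n hn
        obtain ⟨s, _, hs⟩ := (key' n).1 hn
        exact h ⟨s, hs⟩
      simp only [h2, if_false, ite_self]

end RootedGraph.ParentChoice

namespace FractionalAlgorithm

open Classical Leveled LayeredTree

variable {V : Type u}

variable (V) in
/-- The distributions given by the minimizers of the regularizer. -/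
theorem exists_isEntropic : ∃ F : FractionalAlgorithm V, F.IsEntropic := by
  have h : ∀ T : LayeredTree V, ∃ μ : PMF V, T.lastLayer.Nonempty →
      (μ.support ⊆ T.lastLayer ∧
        ∃ x, T.IsMinimizer x ∧ ∀ l ∈ T.lastLayer, μ l = ENNReal.ofReal (x l)) := by
    intro T
    by_cases hT : T.lastLayer.Nonempty
    · have hp := T.isParentMap_getD
      set x := T.config fun v => (T.parent v).getD v with hx
      have hx0 : ∀ l ∈ T.lastLayer, 0 ≤ x l := fun l hl => by
        rw [hx, hp.config_lastLayer hl]; exact mass_nonneg _ _ _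
      refine ⟨PMF.ofFinset (fun l => if l ∈ T.lastLayer then ENNReal.ofReal (x l) else 0)
        T.lastLayer ?_ fun l hl => if_neg hl, fun _ => ⟨?_, x, hp.isMinimizer_config hT,
          fun l hl => ?_⟩⟩
      · rw [Finset.sum_congr rfl fun l hl => if_pos hl, ← ENNReal.ofReal_sum_of_nonneg hx0,
          hp.sum_config hT, ENNReal.ofReal_one]
      · intro l hl
        by_contra h
        exact (PMF.mem_support_iff _ _).1 hl (if_neg h)
      · exact if_pos hl
    · exact ⟨PMF.pure T.root, fun h => absurd h hT⟩
  choose μ hμ using h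
  exact ⟨⟨μ, fun T hT => (hμ T hT).1⟩, fun T hT => (hμ T hT).2⟩

variable {F : FractionalAlgorithm V} {G : RootedGraph V}

lemma IsEntropic.toFun_tree (hF : F.IsEntropic) (p : G.ParentChoice) {t : ℕ}
    (ht : (G.layer t).Nonempty) {l : V} (hl : l ∈ G.layer t) :
    F.toFun (p.tree t) l = ENNReal.ofReal (mass p.parent (G.layer t) t 0 l) := by
  have hT : (p.tree t).lastLayer.Nonempty := by rwa [p.tree_lastLayer]
  have hl' : l ∈ (p.tree t).lastLayer := by rwa [p.tree_lastLayer]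
  obtain ⟨x, hx, hFx⟩ := hF _ hT
  rw [hFx l hl', (p.tree_isParentMap t).eq_config hT hx,
    (p.tree_isParentMap t).config_lastLayer hl', p.tree_lastLayer]
  rfl

lemma support_tree (F : FractionalAlgorithm V) (p : G.ParentChoice) {t : ℕ}
    (ht : (G.layer t).Nonempty) : (F.toFun (p.tree t)).support ⊆ G.layer t := by
  have := F.support_subset (p.tree t) (by rwa [p.tree_lastLayer])
  rwa [p.tree_lastLayer] at this

/-- The transport cost of one step is at most one, for the descent to the new layer, plus the
movement in the tree that was already known. -/
lemma IsEntropic.optimalTransport_le (hF : F.IsEntropic) (p : G.ParentChoice) {t : ℕ}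
    (ht : (G.layer (t + 1)).Nonempty) :
    optimalTransport (p.tree (t + 1)).dist (F.toFun (p.tree t)) (F.toFun (p.tree (t + 1))) ≤
      ENNReal.ofReal (1 + levelDist p.parent (G.layer t) t (mass p.parent (G.layer t) t)
        fun k => mass p.parent (G.layer (t + 1)) (t + 1) (k + 1)) := by
  have ht' := p.layer_nonempty (Nat.le_succ t) ht
  obtain ⟨w, hw, hrow, hcol, hcost⟩ :=
    exists_coupling_mass (p.image_parent_subset t) ht (p.level_root ht')
  refine (optimalTransport_le_of_weights (F.support_tree p ht') (F.support_tree p ht)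
    (fun a ha => hF.toFun_tree p ht' ha) (fun b hb => hF.toFun_tree p ht hb) hw hrow hcol).trans
    (ENNReal.ofReal_le_ofReal ?_)
  have h1 : ∑ a ∈ G.layer t, ∑ b ∈ G.layer (t + 1), w a b * ((p.tree (t + 1)).dist a b : ℝ) ≤
      ∑ a ∈ G.layer t, ∑ b ∈ G.layer (t + 1),
        (w a b + 2 * (w a b * (divergence p.parent t a (p.parent b) : ℝ))) := by
    refine Finset.sum_le_sum fun a ha => Finset.sum_le_sum fun b hb => ?_
    have h2 := (p.tree_isParentMap (t + 1)).dist_le (s := t) (a := a) (b := b)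
      (by rwa [p.tree_layer (Nat.le_succ t)]) (by rwa [p.tree_layer le_rfl])
    have h3 : ((p.tree (t + 1)).dist a b : ℝ) ≤
        1 + 2 * (divergence p.parent t a (p.parent b) : ℝ) := by exact_mod_cast h2
    nlinarith [mul_le_mul_of_nonneg_left h3 (hw a b)]
  have h2 : ∑ a ∈ G.layer t, ∑ b ∈ G.layer (t + 1), w a b = 1 := by
    rw [Finset.sum_congr rfl hrow]
    have := sum_mass (Nat.zero_le _) (p.level_root ht')
    rwa [level_zero] at this
  simp only [Finset.sum_add_distrib, ← Finset.mul_sum] at h1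
  linarith

theorem IsEntropic.isCompetitive (hF : F.IsEntropic) : F.IsCompetitive ratio := by
  intro w G hG p t ht
  have hcard : ∀ s, (G.layer s).card ≤ w := fun s => hG.2 ⟨s, rfl⟩
  set P : ℕ → ℝ := fun s => potential p.parent w (G.layer s) s G.root with hP
  have hw : 1 ≤ w := ht.card_pos.trans_le (hcard t)
  have hnn : ∀ s : ℕ, 0 ≤ 1 + levelDist p.parent (G.layer s) s (mass p.parent (G.layer s) s)
      fun k => mass p.parent (G.layer (s + 1)) (s + 1) (k + 1) := fun s =>
    add_nonneg zero_le_one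
      (Finset.sum_nonneg fun _ _ => Finset.sum_nonneg fun _ _ => abs_nonneg _)
  calc F.cost p t ≤ ∑ s ∈ Finset.range t, ENNReal.ofReal (1 +
        levelDist p.parent (G.layer s) s (mass p.parent (G.layer s) s)
          fun k => mass p.parent (G.layer (s + 1)) (s + 1) (k + 1)) :=
        Finset.sum_le_sum fun s hs => hF.optimalTransport_le p
          (p.layer_nonempty (Finset.mem_range.1 hs) ht)
    _ = ENNReal.ofReal (∑ s ∈ Finset.range t, (1 +
        levelDist p.parent (G.layer s) s (mass p.parent (G.layer s) s)
          fun k => mass p.parent (G.layer (s + 1)) (s + 1) (k + 1))) :=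
        (ENNReal.ofReal_sum_of_nonneg fun s _ => hnn s).symm
    _ ≤ ENNReal.ofReal (ratio w * t) := by
        refine ENNReal.ofReal_le_ofReal ?_
        have h1 : ∀ s ∈ Finset.range t, 1 +
            levelDist p.parent (G.layer s) s (mass p.parent (G.layer s) s)
              (fun k => mass p.parent (G.layer (s + 1)) (s + 1) (k + 1)) ≤
            ratio w + (P s - P (s + 1)) := by
          intro s hs
          have hs1 := p.layer_nonempty (Finset.mem_range.1 hs) ht
          have := levelDist_step (p.image_parent_subset s) hs1
            (p.level_root (p.layer_nonempty (Nat.le_succ s) hs1)) (hcard s) (hcard (s + 1))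
          simp only [hP]
          linarith
        refine (Finset.sum_le_sum h1).trans ?_
        rw [Finset.sum_add_distrib, Finset.sum_range_sub']
        have h0 : P 0 = 0 := by simp [hP, potential, energy, nodeCount]
        have ht0 : 0 ≤ P t := potential_nonneg (by simp [p.level_root ht]) hw
        simp only [Finset.sum_const, Finset.card_range, nsmul_eq_mul, h0]
        linarith

end FractionalAlgorithm

lemma ratio_isBigO : Leveled.ratio =O[atTop] fun w : ℕ => Real.log w ^ 2 := by
  refine Asymptotics.IsBigO.of_bound 25 ?_
  filter_upwards [eventually_ge_atTop 3] with w hw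
  have h1 : 1 ≤ Real.log w := by
    rw [Real.le_log_iff_exp_le (by exact_mod_cast (by omega : 0 < w))]
    have : (3 : ℝ) ≤ w := by exact_mod_cast hw
    linarith [Real.exp_one_lt_d9]
  rw [Leveled.ratio, Real.norm_of_nonneg (by positivity), Real.norm_of_nonneg (by positivity)]
  nlinarith

/-! ### Derived randomized algorithms -/

section Expectation

variable {α β : Type*}

/-- The expectation of a nonnegative function. -/
def PMF.expect (p : PMF α) (g : α → ℝ≥0∞) : ℝ≥0∞ := ∑' a, p a * g a

lemma PMF.expect_bind (p : PMF α) (f : α → PMF β) (g : β → ℝ≥0∞) :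
    (p.bind f).expect g = p.expect fun a => (f a).expect g := by
  simp only [PMF.expect, PMF.bind_apply, ← ENNReal.tsum_mul_right, ← ENNReal.tsum_mul_left]
  rw [ENNReal.tsum_comm]
  simp only [mul_assoc]

lemma PMF.expect_pure (a : α) (g : α → ℝ≥0∞) : (PMF.pure a).expect g = g a := by
  classical
  rw [PMF.expect, tsum_eq_single a]
  · simp
  · intro b hb
    simp [hb]

lemma PMF.expect_map (p : PMF α) (f : α → β) (g : β → ℝ≥0∞) :
    (p.map f).expect g = p.expect fun a => g (f a) := by
  rw [← PMF.bind_pure_comp, PMF.expect_bind]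
  simp only [Function.comp, PMF.expect_pure]

lemma PMF.expect_const (p : PMF α) (c : ℝ≥0∞) : (p.expect fun _ => c) = c := by
  rw [PMF.expect, ENNReal.tsum_mul_right, p.tsum_coe, one_mul]

lemma PMF.expect_add (p : PMF α) (g h : α → ℝ≥0∞) :
    (p.expect fun a => g a + h a) = p.expect g + p.expect h := by
  simp only [PMF.expect, mul_add, ENNReal.tsum_add]

end Expectation

namespace RandomizedAlgorithm

open Classical LayeredTree

variable {V : Type u}

/-- Sampling from the conditional distributions of an optimal coupling. -/
theorem exists_isDerivedFrom (F : FractionalAlgorithm V) :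
    ∃ R : RandomizedAlgorithm V, R.IsDerivedFrom F := by
  have h : ∀ T : LayeredTree V, ∃ ρ : V → PMF V, ∀ n, T.height = n + 1 → T.lastLayer.Nonempty →
      (∀ a, (ρ a).support ⊆ T.lastLayer) ∧
      ∃ π : PMF (V × V), IsOptimalCoupling T.dist (F.toFun (T.truncate n)) (F.toFun T) π ∧
        ∀ a b, π (a, b) = F.toFun (T.truncate n) a * ρ a b := by
    intro T
    by_cases hT : T.lastLayer.Nonempty ∧ ∃ n, T.height = n + 1
    swap
    · exact ⟨PMF.pure, fun n hn hne => absurd ⟨hne, n, hn⟩ hT⟩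
    obtain ⟨hne, n, hn⟩ := hT
    have htr : (T.truncate n).lastLayer = T.layer n := if_pos le_rfl
    have hne' : (T.truncate n).lastLayer.Nonempty := by
      rw [htr]
      obtain ⟨l, hl⟩ := hne
      rw [lastLayer, hn] at hl
      obtain ⟨u, hu, _⟩ := T.parent_of_mem n l hl
      exact ⟨u, hu⟩
    have hμ := F.support_subset _ hne'
    have hν := F.support_subset _ hne
    obtain ⟨π, hπ⟩ := exists_isOptimalCoupling T.dist hμ hν
    obtain ⟨hfst, hsnd⟩ := isCoupling_iff.1 hπ.1
    have hon := hπ.1.isCouplingOn hμ hν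
    set μ := F.toFun (T.truncate n) with hμdef
    refine ⟨fun a => if h : μ a = 0 then PMF.pure hne.choose else
      PMF.normalize (fun b => π (a, b)) (by rwa [hfst a]) (by rw [hfst a]; exact μ.apply_ne_top a),
      fun m hm _ => ?_⟩
    obtain rfl : m = n := by omega
    refine ⟨fun a => ?_, π, hπ, fun a b => ?_⟩
    · dsimp only
      split_ifs with h
      · rw [PMF.support_pure, Set.singleton_subset_iff]
        exact hne.choose_spec
      · intro b hb
        rw [PMF.mem_support_iff, PMF.normalize_apply] at hb
        by_contra hb'
        exact hb (by rw [hon.1 (a, b) (fun hz => hb' (Finset.mem_product.1 hz).2), zero_mul])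
    · rw [← hμdef]
      dsimp only
      split_ifs with h
      · rw [h, zero_mul]
        exact ENNReal.tsum_eq_zero.1 ((hfst a).trans h) b
      · rw [PMF.normalize_apply, hfst a, mul_left_comm,
          ENNReal.mul_inv_cancel h (μ.apply_ne_top a), mul_one]
  choose ρ hρ using h
  exact ⟨⟨ρ, fun T n hn hne a _ => (hρ T n hn hne).1 a⟩, fun T n hn hne => (hρ T n hn hne).2⟩

variable {R : RandomizedAlgorithm V} {F : FractionalAlgorithm V} {G : RootedGraph V}

lemma IsDerivedFrom.step (hR : R.IsDerivedFrom F) (p : G.ParentChoice) {t : ℕ}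
    (ht : (G.layer (t + 1)).Nonempty) :
    (F.toFun (p.tree t)).bind (R.toFun (p.tree (t + 1))) = F.toFun (p.tree (t + 1)) ∧
    ((F.toFun (p.tree t)).expect fun a => (R.toFun (p.tree (t + 1)) a).expect fun b =>
      ((p.tree (t + 1)).dist a b : ℝ≥0∞)) =
      optimalTransport (p.tree (t + 1)).dist (F.toFun (p.tree t)) (F.toFun (p.tree (t + 1))) := by
  obtain ⟨π, ⟨hπ, hopt⟩, hcond⟩ := hR (p.tree (t + 1)) t rfl (by rwa [p.tree_lastLayer])
  rw [p.truncate_tree] at hπ hopt hcond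
  constructor
  · ext b
    rw [PMF.bind_apply, ← (isCoupling_iff.1 hπ).2 b]
    exact tsum_congr fun a => (hcond a b).symm
  · rw [← hopt, transportCost, ENNReal.tsum_prod']
    simp only [PMF.expect, ← ENNReal.tsum_mul_left, hcond, mul_assoc]

lemma IsDerivedFrom.law (hR : R.IsDerivedFrom F) (p : G.ParentChoice) (t : ℕ)
    (ht : (G.layer t).Nonempty) :
    (R.law p t).map Prod.fst = F.toFun (p.tree t) ∧ R.expectedCost p t = F.cost p t := by
  have hE : ∀ t, R.expectedCost p t = (R.law p t).expect fun s => (s.2 : ℝ≥0∞) := fun _ => rfl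
  induction t with
  | zero =>
    constructor
    · rw [RandomizedAlgorithm.law, PMF.pure_map]
      have h1 := F.support_tree p ht
      have hroot : G.layer 0 = {G.root} := by
        rw [← p.tree_layer le_rfl]; exact (p.tree 0).layer_zero
      rw [hroot, Finset.coe_singleton] at h1
      have h2 : (F.toFun (p.tree 0)).support = {G.root} :=
        (Set.subset_singleton_iff_eq.1 h1).resolve_left (PMF.support_nonempty _).ne_empty
      have h3 : F.toFun (p.tree 0) G.root = 1 := (PMF.apply_eq_one_iff _ _).2 h2
      ext b
      rw [PMF.pure_apply]
      split_ifs with hb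
      · subst hb; exact h3.symm
      · exact ((PMF.apply_eq_zero_iff _ _).2 (by rw [h2]; exact hb)).symm
    · rw [hE, RandomizedAlgorithm.law, PMF.expect_pure]
      simp [FractionalAlgorithm.cost]
  | succ t ih =>
    obtain ⟨ih1, ih2⟩ := ih (p.layer_nonempty (Nat.le_succ t) ht)
    obtain ⟨hs1, hs2⟩ := hR.step p ht
    constructor
    · rw [RandomizedAlgorithm.law, PMF.map_bind]
      simp only [PMF.map_comp]
      have : ∀ s : V × ℕ, (R.toFun (p.tree (t + 1)) s.1).map
          (Prod.fst ∘ fun v => (v, s.2 + (p.tree (t + 1)).dist s.1 v)) =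
          R.toFun (p.tree (t + 1)) s.1 := fun s => PMF.map_id _
      simp only [this]
      rw [← hs1, ← ih1, PMF.bind_map]
      rfl
    · rw [hE, RandomizedAlgorithm.law, PMF.expect_bind]
      simp only [PMF.expect_map, Nat.cast_add, PMF.expect_add, PMF.expect_const]
      rw [← hE, ih2, FractionalAlgorithm.cost, FractionalAlgorithm.cost, Finset.sum_range_succ, ← hs2, ← ih1, PMF.expect_map]

theorem IsDerivedFrom.isCompetitive (hR : R.IsDerivedFrom F) {c : ℕ → ℝ}
    (hF : F.IsCompetitive c) : R.IsCompetitive c := by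
  intro w G hG p t ht
  rw [(hR.law p t ht).2]
  exact hF w G hG p t ht

end RandomizedAlgorithm
end

theorem theorem1 :
    (∀ (V : Type u) (T : LayeredTree V), T.lastLayer.Nonempty → ∃! x : V → ℝ, T.IsMinimizer x) ∧
    ∃ c : ℕ → ℝ, c =O[atTop] (fun w : ℕ => Real.log w ^ 2) ∧
      ∀ V : Type u,
        (∃ F : FractionalAlgorithm V, F.IsEntropic) ∧
        ∀ F : FractionalAlgorithm V, F.IsEntropic →
          F.IsCompetitive c ∧
          (∃ R : RandomizedAlgorithm V, R.IsDerivedFrom F) ∧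
          ∀ R : RandomizedAlgorithm V, R.IsDerivedFrom F → R.IsCompetitive c :=
  ⟨fun _ _ hT => LayeredTree.existsUnique_isMinimizer hT, Leveled.ratio, ratio_isBigO,
    fun V => ⟨FractionalAlgorithm.exists_isEntropic V, fun F hF => ⟨hF.isCompetitive,
      RandomizedAlgorithm.exists_isDerivedFrom F, fun _ hR => hR.isCompetitive hF.isCompetitive⟩⟩⟩
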